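/- Let $\mathbb{K}$ be an algebraically closed field, let $X_{mn}=(x_{ij})$ be the generic $m\times n$ matrix, whose entries are independent variables, and let $I_{mn}\subseteq \mathbb{K}[x_{ij}]$ be the ideal generated by the $2\times 2$ minors of $X_{mn}$. For an ideal $I$ of a Noetherian ring $R$, the $s$-th symbolic power $I^{(s)}$ is the contraction to $R$ of the extension of $I^s$ to the localization of $R$ at the complement of the union of the minimal primes of $I$. The join of ideals $I,J\subseteq\mathbb{K}[\mathbf{x}]$ is $$I\ast J=\bigl(I(\mathbf{y})+J(\mathbf{z})+\langle x_i-y_i-z_i\rangle_i\bigr)\cap\mathbb{K}[\mathbf{x}],$$ and for $r\ge 1$ the $r$-th secant ideal $I^{\{r\}}=I\ast\cdots\ast I$ is the $r$-fold join of $I$ with itself. An ideal $I\subseteq\mathbb{K}[\mathbf{x}]$ is called differentially perfect if for all $r\ge 1$ and $s\ge 1$ $$\bigl(I^{\{r\}}\bigr)^{(s)}=I^{\{r+s-1\}}+\sum_{i=1}^{s-1}\bigl(I^{\{r\}}\bigr)^{(i)}\bigl(I^{\{r\}}\bigr)^{(s-i)}.$$ A term order is called diagonal if the leading term of every minor of $X_{mn}$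 is the product of the entries on the main diagonal of that minor. **Theorem.** The ideal $I_{mn}$ is differentially perfect. Moreover, for every $r\ge 1$ the secant ideal $I_{mn}^{\{r\}}$ is the ideal generated by the $(r+1)\times(r+1)$ minors of $X_{mn}$, and for every $s\ge 1$ $$\bigl(I_{mn}^{\{r\}}\bigr)^{(s)}=\Bigl\langle\ \prod_{i=1}^{l}f_i\ \Bigm|\ l\ge 0,\ \text{each } f_i \text{ is a minor of } X_{mn} \text{ of size at least } r+1,\ \sum_{i=1}^{l}(\deg f_i-r)=s\ \Bigr\rangle .$$ These products of minors form a (finite) Gröbner basis of $\bigl(I_{mn}^{\{r\}}\bigr)^{(s)}$ with respect to every diagonal term order. -/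

import Mathlib

open MvPolynomial

noncomputable section

namespace DetSymb

section SymbolicPower

variable {R : Type*} [CommRing R]

/-- The elements of `R` lying in no minimal prime of `I`. -/
def minimalPrimesCompl (I : Ideal R) : Submonoid R where
  carrier := {x | ∀ p ∈ I.minimalPrimes, x ∉ p}
  one_mem' := fun p hp h => hp.1.1.ne_top ((Ideal.eq_top_iff_one p).mpr h)
  mul_mem' := fun ha hb p hp h => (hp.1.1.mem_or_mem h).elim (ha p hp) (hb p hp)

/-- The `s`-th symbolic power of `I`: the contraction to `R` of the extension of `I ^ s` to the
localization of `R` at the complement of the union of the minimal primes of `I`. -/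
def symbolicPower (I : Ideal R) (s : ℕ) : Ideal R :=
  ((I ^ s).map (algebraMap R (Localization (minimalPrimesCompl I)))).comap
    (algebraMap R (Localization (minimalPrimesCompl I)))

end SymbolicPower

section Secant

variable {σ K : Type*} [Field K]

/-- The join of two ideals of `K[x]`. The ring `K[x, y, z]` has variables indexed by `σ ⊕ σ ⊕ σ`,
the three summands indexing the `x`, the `y` and the `z`; the join is
`(I(y) + J(z) + ⟨x_i - y_i - z_i⟩) ∩ K[x]`. -/
def join (I J : Ideal (MvPolynomial σ K)) : Ideal (MvPolynomial σ K) :=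
  (I.map (rename (R := K) fun i : σ => (Sum.inr (Sum.inl i) : σ ⊕ σ ⊕ σ)) ⊔
      J.map (rename (R := K) fun i : σ => (Sum.inr (Sum.inr i) : σ ⊕ σ ⊕ σ)) ⊔
      Ideal.span (Set.range fun i : σ =>
        (X (Sum.inl i) - X (Sum.inr (Sum.inl i)) - X (Sum.inr (Sum.inr i)) :
          MvPolynomial (σ ⊕ σ ⊕ σ) K))).comap
    (rename (R := K) fun i : σ => (Sum.inl i : σ ⊕ σ ⊕ σ))

/-- The `r`-th secant ideal, i.e. the `r`-fold join of `I` with itself, for `r ≥ 1`.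
(For `r = 0` it is the ideal of the origin, which is the neutral element of the join.) -/
def secantIdeal (I : Ideal (MvPolynomial σ K)) : ℕ → Ideal (MvPolynomial σ K)
  | 0 => Ideal.span (Set.range X)
  | 1 => I
  | r + 2 => join (secantIdeal I (r + 1)) I

/-- `I` is `r`-differentially perfect. -/
def IsDiffPerfectAt (I : Ideal (MvPolynomial σ K)) (r : ℕ) : Prop :=
  ∀ s : ℕ, 1 ≤ s →
    symbolicPower (secantIdeal I r) s =
      secantIdeal I (r + s - 1) +
        ∑ i ∈ Finset.Icc 1 (s - 1),
          symbolicPower (secantIdeal I r) i * symbolicPower (secantIdeal I r) (s - i)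

/-- `I` is differentially perfect. -/
def IsDiffPerfect (I : Ideal (MvPolynomial σ K)) : Prop :=
  ∀ r : ℕ, 1 ≤ r → IsDiffPerfectAt I r

end Secant

section Groebner

variable {σ K : Type*} [Field K]

/-- The initial ideal of a set of polynomials: the ideal generated by its leading terms. -/
def initialIdeal (ord : MonomialOrder σ) (S : Set (MvPolynomial σ K)) :
    Ideal (MvPolynomial σ K) :=
  Ideal.span (ord.leadingTerm '' S)

/-- `G` is a Gröbner basis of `I` with respect to the term order `ord`. -/
def IsGroebnerBasis (ord : MonomialOrder σ) (I : Ideal (MvPolynomial σ K))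
    (G : Set (MvPolynomial σ K)) : Prop :=
  G.Finite ∧ G ⊆ (I : Set (MvPolynomial σ K)) ∧
    initialIdeal ord G = initialIdeal ord (I : Set (MvPolynomial σ K))

end Groebner

section Minors

/-- The set of all `t × t` minors of a matrix: rows and columns are chosen by strictly
increasing maps. -/
def minors {R : Type*} [CommRing R] {m n : ℕ} (A : Matrix (Fin m) (Fin n) R) (t : ℕ) : Set R :=
  {f | ∃ (a : Fin t ↪o Fin m) (b : Fin t ↪o Fin n), f = (A.submatrix a b).det}

/-- The set of all minors of size at least `r`. -/
def minorsGE {R : Type*} [CommRing R] {m n : ℕ} (A : Matrix (Fin m) (Fin n) R) (r : ℕ) : Set R :=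
  {f | ∃ t : ℕ, r ≤ t ∧ f ∈ minors A t}

variable (K : Type*) [Field K] (m n : ℕ)

/-- The generic `m × n` matrix, whose entries are independent variables. -/
abbrev genericMatrix : Matrix (Fin m) (Fin n) (MvPolynomial (Fin m × Fin n) K) :=
  Matrix.mvPolynomialX (Fin m) (Fin n) K

/-- The ideal generated by the `t × t` minors of the generic `m × n` matrix. -/
def minorIdeal (t : ℕ) : Ideal (MvPolynomial (Fin m × Fin n) K) :=
  Ideal.span (minors (genericMatrix K m n) t)

/-- All products `f₁ ⋯ f_l` of minors of size at least `r + 1` of the generic matrix with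
`∑ (deg f_i - r) = s`. -/
def minorProducts (r s : ℕ) : Set (MvPolynomial (Fin m × Fin n) K) :=
  {g | ∃ (l : ℕ) (f : Fin l → MvPolynomial (Fin m × Fin n) K),
    (∀ i, f i ∈ minorsGE (genericMatrix K m n) (r + 1)) ∧
    ∑ i, (((f i).totalDegree : ℤ) - (r : ℤ)) = (s : ℤ) ∧
    g = ∏ i, f i}

variable {m n}

/-- A term order is diagonal if the leading term of every minor of the generic matrix is the
product of the entries on its main diagonal. -/
def IsDiagonal (ord : MonomialOrder (Fin m × Fin n)) : Prop :=
  ∀ (t : ℕ) (a : Fin t ↪o Fin m) (b : Fin t ↪o Fin n),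
    ord.leadingTerm ((genericMatrix K m n).submatrix a b).det =
      ∏ i, (X (a i, b i) : MvPolynomial (Fin m × Fin n) K)

end Minors

end DetSymb

end

/-! Let J_r be the kernel of x = UV with inner dimension r, the prime ideal of the matrices of rank
at most r. Everything follows from one statement about leading exponents: if 0 ≠ f ∈ J_r^(s), then
the leading exponent of f is divisible by that of a product of minors of total excess s
(`exists_minorProduct_degree_le`).

Order matrix positions by "strictly smaller row and column". Chains are the main diagonals of
minors, so a family of chains inside the multiset M = deg f yields a product of minors. Weighted
Greene–Kleitman duality (`exists_chains_and_antichains`) leaves two cases. Either the chains have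
total excess over r at least s, and shrinking them gives the product; or an exponent c of degree
less than s can be removed from M so that the rest b is supported on r antichains.

The second case is impossible. The Hasse derivative of f at c lies in J_r
(`hasse_mem_of_mem_symbolicPower`) and has leading exponent b, while no nonzero element of J_r has a
leading exponent supported on r antichains (`not_colorable_of_mem_rankIdeal`). The latter is an
induction on r: writing a matrix of rank r+1 as y + uvᵀ, the sum of Hasse derivatives over all
exponents with given margins maps J_{r+1} to J_r, and an antichain is the smallest exponent with its
margins, so one antichain can be stripped from the leading exponent.

Conversely a Schur complement puts minors of size r+k into J_r^(k) (`minor_mem_symbolicPower`).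
Division by the monic products then gives generation, the Gröbner basis property and, for s = 1,
generation of J_r by minors. The same expansion at y + uvᵀ shows J_{r+1} = J_r ∗ J_1, which
identifies the secant ideals; differential perfection is read off by splitting one factor from each
product. -/

noncomputable section

namespace DetSymb

/-! ### Matching duality, chains and antichains -/

section Combinatorics

open Finset

/-- Integral duality for the assignment problem: there are an integral dual solution and a perfect
matching all of whose edges are tight for it. -/
theorem exists_tight_perm {V : Type*} [Fintype V] (ok : V → V → Prop) (W : V → V → ℤ)
    (hid : ∀ x, ok x x) :
    ∃ (u v : V → ℤ) (π : Equiv.Perm V), (∀ x y, ok x y → W x y ≤ u x + v y) ∧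
      ∀ x, ok x (π x) ∧ W x (π x) = u x + v (π x) := by
  classical
  -- An optimal integral dual solution exists because the dual value is bounded below by the weight
  -- of the identity matching; Hall's theorem then finds a perfect matching of tight edges.
  let S : Set ((V → ℤ) × (V → ℤ)) := {p | ∀ x y, ok x y → W x y ≤ p.1 x + p.2 y}
  have hS : S.Nonempty := by
    refine ⟨(fun x => ∑ y, |W x y|, 0), fun x y _ => ?_⟩
    have h1 : |W x y| ≤ ∑ y, |W x y| :=
      single_le_sum (f := fun y => |W x y|) (fun _ _ => abs_nonneg _) (mem_univ y)
    simpa using (le_abs_self _).trans h1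
  let val : (V → ℤ) × (V → ℤ) → ℤ := fun p => ∑ x, (p.1 x + p.2 x) - ∑ x, W x x
  have hval : ∀ p ∈ S, 0 ≤ val p := fun p hp =>
    sub_nonneg.mpr (sum_le_sum fun x _ => hp x x (hid x))
  obtain ⟨⟨u, v⟩, huv, hmin⟩ :=
    WellFounded.has_min (measure fun p => (val p).toNat).wf S hS
  have hmin' : ∀ p ∈ S, val (u, v) ≤ val p := by
    intro p hp
    have h1 := hmin p hp
    have h2 := hval p hp
    have h3 := hval _ huv
    change ¬ ((val p).toNat < (val (u, v)).toNat) at h1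
    omega
  have hall : ∀ A : Finset V,
      #A ≤ #{b | ∃ a ∈ A, ok a b ∧ W a b = u a + v b} := by
    intro A
    by_contra hA
    push Not at hA
    set N : Finset V := {b | ∃ a ∈ A, ok a b ∧ W a b = u a + v b} with hN
    -- If A violates Hall's condition, lower u by 1 on A and raise v by 1 on its tight neighbours N.
    -- By integrality non-tight edges have slack at least 1, so feasibility survives while the value
    -- drops by #A - #N > 0.
    let p : (V → ℤ) × (V → ℤ) :=
      (fun x => u x - if x ∈ A then 1 else 0, fun y => v y + if y ∈ N then 1 else 0)
    have hp : p ∈ S := by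
      intro x y hxy
      have h0 : W x y ≤ u x + v y := huv x y hxy
      by_cases hx : x ∈ A <;> by_cases hy : y ∈ N
      · simp only [p, hx, hy, if_true]; linarith
      · have h1 : W x y ≠ u x + v y := fun h =>
          hy (by rw [hN, mem_filter]; exact ⟨mem_univ _, x, hx, hxy, h⟩)
        simp only [p, hx, hy, if_true, if_false]
        have := lt_of_le_of_ne h0 h1
        omega
      · simp only [p, hx, hy, if_true, if_false]; linarith
      · simp only [p, hx, hy, if_false]; linarith
    have h1 := hmin' p hp
    have h2 : val p = val (u, v) - #A + #N := by
      simp only [val, p, sum_add_distrib, sum_sub_distrib, sum_ite_mem, univ_inter, sum_const,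
        nsmul_eq_mul, mul_one]
      ring
    omega
  obtain ⟨f, hf, hf'⟩ := (Fintype.all_card_le_filter_rel_iff_exists_injective
    (fun a b => ok a b ∧ W a b = u a + v b)).mp hall
  exact ⟨u, v, Equiv.ofBijective f (Finite.injective_iff_bijective.mp hf), huv, hf'⟩

/-- Weighted Greene–Kleitman duality in a finite strict order: there are a family of chains
fitting into the multiset `M`, and a partial colouring by `r` antichains missing at most
`∑ (|C| - r)` elements of `M`. -/
theorem exists_chains_and_antichains {σ : Type*} [Fintype σ] [DecidableEq σ] (lt : σ → σ → Prop)
    (irrefl : ∀ x, ¬ lt x x) (trans : ∀ x y z, lt x y → lt y z → lt x z) (M : σ →₀ ℕ) (r : ℕ) :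
    ∃ (L : List (Finset σ)) (A : Finset σ) (h : σ → ℕ),
      (∀ C ∈ L, ∀ x ∈ C, ∀ y ∈ C, x ≠ y → lt x y ∨ lt y x) ∧
      (L.map fun C => ∑ x ∈ C, Finsupp.single x 1).sum ≤ M ∧
      (∀ x ∈ A, h x < r) ∧ (∀ x ∈ A, ∀ y ∈ A, lt x y → h x ≠ h y) ∧
      ∑ x ∈ Aᶜ, (M x : ℤ) ≤ (L.map fun C => (#C : ℤ) - r).sum := by
  classical
  -- E consists of the elements of M with multiplicity; `Option E` provides dummy vertices that
  -- start and end chains.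
  let E := Σ x : σ, Fin (M x)
  let lt' : E → E → Prop := fun p q => lt p.1 q.1
  let ok : E ⊕ Option E → E ⊕ Option E → Prop
    | .inl p, .inl q => p = q ∨ lt' p q
    | _, _ => True
  -- A fixed element is left uncovered, an edge p → q makes q follow p in a chain, and dummy → q
  -- starts a chain. A chain of k elements weighs (1 - r) + (k - 1) = k - r.
  let W : E ⊕ Option E → E ⊕ Option E → ℤ
    | .inl p, .inl q => if p = q then 0 else 1
    | .inr _, .inl _ => 1 - r
    | _, _ => 0
  obtain ⟨u, v, π, hfeas, htight⟩ := exists_tight_perm ok W (by rintro (p | d) <;> simp [ok])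
  let R : E → E → Prop := fun p q => π (.inl p) = .inl q ∧ p ≠ q
  have hR : ∀ p q, R p q → lt' p q := by
    intro p q ⟨h1, h2⟩
    have := (htight (.inl p)).1
    rw [h1] at this
    exact this.resolve_left h2
  let U : Finset E := {q | π (.inl q) ≠ .inl q}
  let T : Finset E := {q | ∃ d, π (.inr d) = .inl q}
  have hpred : ∀ q ∈ U, q ∈ T ∨ ∃ p ∈ U, R p q := by
    intro q hq
    obtain ⟨z, hz⟩ := π.surjective (.inl q)
    rcases z with p | d
    · have hpq : p ≠ q := by
        rintro rfl
        exact (mem_filter.mp hq).2 hz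
      refine .inr ⟨p, mem_filter.mpr ⟨mem_univ _, ?_⟩, hz, hpq⟩
      rw [hz]
      simpa using hpq.symm
    · exact .inl (mem_filter.mpr ⟨mem_univ _, d, hz⟩)
  have hTU : T ⊆ U := by
    intro q hq
    obtain ⟨d, hd⟩ := (mem_filter.mp hq).2
    refine mem_filter.mpr ⟨mem_univ _, fun h => ?_⟩
    simpa using π.injective (h.trans hd.symm)
  -- Every covered element receives weight 1 from its incoming edge, and every chain start pays r.
  have htotal : ∑ x, u x + ∑ x, v x = #U - r * #T := by
    calc ∑ x, u x + ∑ x, v x = ∑ x, u x + ∑ x, v (π x) := by rw [Equiv.sum_comp π v]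
      _ = ∑ x, W x (π x) := by
        rw [← sum_add_distrib]; exact sum_congr rfl fun x _ => (htight x).2.symm
      _ = ∑ y, W (π.symm y) y := by
        rw [← Equiv.sum_comp π fun y => W (π.symm y) y]; simp
      _ = ∑ q : E, W (π.symm (.inl q)) (.inl q) := by
        rw [Fintype.sum_sum_type]
        have : ∀ d, W (π.symm (.inr d)) (.inr d) = 0 := by
          intro d; rcases π.symm (.inr d) with a | a <;> rfl
        simp [this]
      _ = ∑ q : E, ((if q ∈ U then (1 : ℤ) else 0) - r * (if q ∈ T then (1 : ℤ) else 0)) := by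
        refine sum_congr rfl fun q _ => ?_
        obtain ⟨z, hz⟩ := π.surjective (.inl q)
        rw [← hz, Equiv.symm_apply_apply, hz]
        rcases z with p | d
        · have hT : q ∉ T := by
            intro hq
            obtain ⟨d, hd⟩ := (mem_filter.mp hq).2
            simpa using π.injective (hz.trans hd.symm)
          by_cases hpq : p = q
          · subst hpq
            have hU : p ∉ U := by simp [U, hz]
            simp [W, hT, hU]
          · have hU : q ∈ U := by
              refine mem_filter.mpr ⟨mem_univ _, fun h => hpq ?_⟩
              simpa using π.injective (hz.trans h.symm)
            simp [W, hT, hU, hpq]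
        · have hT : q ∈ T := mem_filter.mpr ⟨mem_univ _, d, hz⟩
          simp [W, hT, hTU hT]
      _ = #U - r * #T := by
        rw [sum_sub_distrib, ← mul_sum]; simp
  -- the chains
  have hwf : WellFounded lt' :=
    haveI : IsTrans E lt' := ⟨fun a b c => trans a.1 b.1 c.1⟩
    haveI : Std.Irrefl lt' := ⟨fun a => irrefl a.1⟩
    Finite.wellFounded_of_trans_of_irrefl lt'
  -- Following the chain backwards, by well-founded induction, labels each covered element by its
  -- start; chains are the fibres of this label.
  have hroot : ∀ q, ∃ s, q ∈ U → s ∈ T ∧ Relation.ReflTransGen R s q := by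
    intro q
    induction q using hwf.induction with
    | _ q ih =>
      by_cases hq : q ∈ U
      · rcases hpred q hq with h | ⟨p, hp, hpq⟩
        · exact ⟨q, fun _ => ⟨h, .refl⟩⟩
        · obtain ⟨s, hs⟩ := ih p (hR p q hpq)
          exact ⟨s, fun _ => ⟨(hs hp).1, (hs hp).2.tail hpq⟩⟩
      · exact ⟨q, fun h => absurd h hq⟩
  choose root hroot using hroot
  have htransgen : ∀ x y, Relation.ReflTransGen R x y → x = y ∨ lt' x y := by
    intro x y hxy
    induction hxy with
    | refl => exact .inl rfl
    | tail _ h ih =>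
      rcases ih with rfl | ih
      · exact .inr (hR _ _ h)
      · exact .inr (trans _ _ _ ih (hR _ _ h))
  have hchain : ∀ x ∈ U, ∀ y ∈ U, root x = root y → x ≠ y → lt' x y ∨ lt' y x := by
    intro x hx y hy hxy hne
    have h1 := (hroot x hx).2
    have h2 := (hroot y hy).2
    rw [← hxy] at h2
    have huniq : Relator.RightUnique R := by
      intro a b c hb hc
      simpa using hb.1.symm.trans hc.1
    rcases Relation.ReflTransGen.total_of_right_unique huniq h1 h2 with h | h
    · exact .inl ((htransgen _ _ h).resolve_left hne)
    · exact .inr ((htransgen _ _ h).resolve_left hne.symm)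
  let fib : E → Finset E := fun s => {x ∈ U | root x = s}
  have hfibchain : ∀ s, ∀ x ∈ fib s, ∀ y ∈ fib s, x ≠ y → lt' x y ∨ lt' y x := by
    intro s x hx y hy
    obtain ⟨hx, hx'⟩ := mem_filter.mp hx
    obtain ⟨hy, hy'⟩ := mem_filter.mp hy
    exact hchain x hx y hy (hx'.trans hy'.symm)
  -- Copies of one position are incomparable, so a chain contains at most one of them.
  have hinj : ∀ s, Set.InjOn Sigma.fst (fib s : Set E) := by
    intro s x hx y hy hxy
    by_contra hne
    rcases hfibchain s x hx y hy hne with h | h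
    · exact irrefl y.1 (by simpa only [lt', hxy] using h)
    · exact irrefl y.1 (by simpa only [lt', hxy] using h)
  have hmaps : ∀ x ∈ U, root x ∈ T := fun x hx => (hroot x hx).1
  -- the colouring
  have hy : ∀ p : E, 0 ≤ u (.inl p) + v (.inl p) := fun p => by
    simpa [W] using hfeas (.inl p) (.inl p) (.inl rfl)
  obtain ⟨d₁, -, hd₁⟩ := exists_min_image univ (fun d : Option E => u (.inr d)) univ_nonempty
  obtain ⟨d₂, -, hd₂⟩ := exists_min_image univ (fun d : Option E => v (.inr d)) univ_nonempty
  have hsplit : ∑ x, u x + ∑ x, v x =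
      ∑ p : E, (u (.inl p) + v (.inl p)) + ∑ d : Option E, (u (.inr d) + v (.inr d)) := by
    rw [Fintype.sum_sum_type, Fintype.sum_sum_type, sum_add_distrib, sum_add_distrib]
    ring
  have hab0 : 0 ≤ u (.inr d₁) + v (.inr d₂) := hfeas (.inr d₁) (.inr d₂) trivial
  have hD : ∀ d, u (.inr d₁) + v (.inr d₂) ≤ u (.inr d) + v (.inr d) := fun d =>
    add_le_add (hd₁ d (mem_univ _)) (hd₂ d (mem_univ _))
  -- There is one dummy more than elements: if each contributed at least 1, the dual value would
  -- exceed #E, yet it is #U - r · #T ≤ #E.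
  have hab : u (.inr d₁) + v (.inr d₂) = 0 := by
    by_contra hne
    have h1 : ∀ d : Option E, 1 ≤ u (.inr d) + v (.inr d) := fun d => by
      have := hD d
      omega
    have h2 : (Fintype.card E : ℤ) + 1 ≤ ∑ d : Option E, (u (.inr d) + v (.inr d)) := by
      calc (Fintype.card E : ℤ) + 1 = ∑ d : Option E, 1 := by simp
        _ ≤ _ := sum_le_sum fun d _ => h1 d
    have h3 : 0 ≤ ∑ p : E, (u (.inl p) + v (.inl p)) := sum_nonneg fun p _ => hy p
    have h4 : (#U : ℤ) ≤ Fintype.card E := by exact_mod_cast card_le_univ U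
    have h5 : (0 : ℤ) ≤ r * #T := by positivity
    linarith
  -- On A some copy has u = -v. The colour u + v(d₂) then lies in [0, r) by feasibility of the edges
  -- to d₂ and from d₁. All copies outside A cost at least 1 in the dual value.
  let A : Finset σ := {x | ∃ k, u (.inl ⟨x, k⟩) + v (.inl ⟨x, k⟩) = 0}
  have hA : ∀ x, ∃ k : ℤ, x ∈ A → ∃ i, u (.inl ⟨x, i⟩) + v (.inl ⟨x, i⟩) = 0 ∧
      k = u (.inl ⟨x, i⟩) := by
    intro x
    by_cases hx : x ∈ A
    · obtain ⟨i, hi⟩ := (mem_filter.mp hx).2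
      exact ⟨_, fun _ => ⟨i, hi, rfl⟩⟩
    · exact ⟨0, fun h => absurd h hx⟩
  choose k hk using hA
  have hkb : ∀ x ∈ A, 0 ≤ k x + v (.inr d₂) ∧ k x + v (.inr d₂) < r := by
    intro x hx
    obtain ⟨i, hi, hki⟩ := hk x hx
    have h1 : 0 ≤ u (.inl ⟨x, i⟩) + v (.inr d₂) := hfeas (.inl ⟨x, i⟩) (.inr d₂) trivial
    have h2 : 1 - (r : ℤ) ≤ u (.inr d₁) + v (.inl ⟨x, i⟩) :=
      hfeas (.inr d₁) (.inl ⟨x, i⟩) trivial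
    rw [hki]
    omega
  refine ⟨T.toList.map fun s => (fib s).image Sigma.fst, A,
    fun x => (k x + v (.inr d₂)).toNat, ?_, ?_, ?_, ?_, ?_⟩
  · intro C hC x hx y hy hxy
    obtain ⟨s, -, rfl⟩ := List.mem_map.mp hC
    obtain ⟨x, hx', rfl⟩ := mem_image.mp hx
    obtain ⟨y, hy', rfl⟩ := mem_image.mp hy
    exact hfibchain s x hx' y hy' fun h => hxy (by rw [h])
  · rw [List.map_map, Function.comp_def, sum_map_toList]
    calc ∑ s ∈ T, ∑ x ∈ (fib s).image Sigma.fst, Finsupp.single x 1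
        = ∑ s ∈ T, ∑ x ∈ U with root x = s, Finsupp.single x.1 1 :=
          sum_congr rfl fun s _ => sum_image (hinj s)
      _ = ∑ x ∈ U, Finsupp.single x.1 1 := sum_fiberwise_of_maps_to hmaps _
      _ ≤ ∑ x : E, Finsupp.single x.1 1 :=
          sum_le_sum_of_subset_of_nonneg (subset_univ U) fun _ _ _ => zero_le
      _ = M := by
          rw [Fintype.sum_sigma]
          simp only [sum_const, card_univ, Fintype.card_fin, Finsupp.smul_single, smul_eq_mul,
            mul_one]
          exact Finsupp.univ_sum_single M
  · intro x hx
    have := hkb x hx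
    dsimp only
    omega
  · intro x hx y hy hxy heq
    have h1 := hkb x hx
    have h2 := hkb y hy
    obtain ⟨i, hi, hki⟩ := hk x hx
    obtain ⟨j, hj, hkj⟩ := hk y hy
    -- With v = -u at the copy of y, feasibility says that u drops by at least 1 from x to y.
    have h3 := hfeas (.inl ⟨x, i⟩) (.inl ⟨y, j⟩) (.inr hxy)
    have hne : (⟨x, i⟩ : E) ≠ ⟨y, j⟩ := by
      intro h
      have : x = y := congrArg Sigma.fst h
      subst this
      exact irrefl _ hxy
    simp only [W, hne, if_false] at h3
    dsimp only at heq
    omega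
  · rw [List.map_map, Function.comp_def, sum_map_toList]
    have h1 : ∑ s ∈ T, ((#((fib s).image Sigma.fst) : ℤ) - r) = #U - r * #T := by
      rw [sum_sub_distrib, sum_const, nsmul_eq_mul, mul_comm]
      congr 1
      rw [card_eq_sum_card_fiberwise hmaps]
      push_cast
      exact sum_congr rfl fun s _ => by rw [card_image_of_injOn (hinj s)]
    rw [h1, ← htotal, hsplit]
    have h2 : 0 ≤ ∑ d : Option E, (u (.inr d) + v (.inr d)) :=
      sum_nonneg fun d _ => by linarith [hD d]
    have h3 : ∑ x ∈ Aᶜ, (M x : ℤ) ≤ ∑ p : E, (u (.inl p) + v (.inl p)) := by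
      rw [Fintype.sum_sigma]
      refine le_trans ?_ (sum_le_sum_of_subset_of_nonneg (subset_univ Aᶜ) fun x _ _ =>
        sum_nonneg fun i _ => hy ⟨x, i⟩)
      refine sum_le_sum fun x hx => ?_
      calc (M x : ℤ) = ∑ i : Fin (M x), 1 := by simp
        _ ≤ _ := sum_le_sum fun i _ => ?_
      have h4 := hy ⟨x, i⟩
      have h5 : u (.inl ⟨x, i⟩) + v (.inl ⟨x, i⟩) ≠ 0 := fun h =>
        mem_compl.mp hx (mem_filter.mpr ⟨mem_univ _, i, h⟩)
      omega
    linarith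

/-- A family of chains can be shrunk so that each has more than `r` elements and the total excess
over `r` is exactly `s`. -/
theorem exists_chains_excess_eq {σ : Type*} [DecidableEq σ] {lt : σ → σ → Prop} (r s : ℕ)
    (L : List (Finset σ)) (hL : ∀ C ∈ L, ∀ x ∈ C, ∀ y ∈ C, x ≠ y → lt x y ∨ lt y x)
    (hs : (s : ℤ) ≤ (L.map fun C => (#C : ℤ) - r).sum) :
    ∃ L' : List (Finset σ), (∀ C ∈ L', ∀ x ∈ C, ∀ y ∈ C, x ≠ y → lt x y ∨ lt y x) ∧
      (∀ C ∈ L', r < #C) ∧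
      (L'.map fun C => ∑ x ∈ C, (Finsupp.single x 1 : σ →₀ ℕ)).sum ≤
        (L.map fun C => ∑ x ∈ C, Finsupp.single x 1).sum ∧
      (L'.map fun C => (#C : ℤ) - r).sum = s := by
  induction L generalizing s with
  | nil =>
    simp only [List.map_nil, List.sum_nil] at hs
    exact ⟨[], by simp, by simp, by simp, by simp; omega⟩
  | cons C L ih =>
    have hL' := fun D hD => hL D (List.mem_cons_of_mem C hD)
    simp only [List.map_cons, List.sum_cons] at hs
    by_cases hC : #C ≤ r
    · obtain ⟨L', h1, h2, h3, h4⟩ := ih s hL' (by omega)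
      exact ⟨L', h1, h2, h3.trans (by simp), h4⟩
    push Not at hC
    by_cases hCs : #C - r ≤ s
    · obtain ⟨L', h1, h2, h3, h4⟩ := ih (s - (#C - r)) hL' (by omega)
      refine ⟨C :: L', ?_, ?_, ?_, ?_⟩
      · simpa using ⟨hL C (by simp), h1⟩
      · simpa using ⟨hC, h2⟩
      · simpa using h3
      · simp only [List.map_cons, List.sum_cons, h4]; omega
    -- Truncation to r + s elements supplies the missing excess; for s = 0 it would leave only r
    -- elements, which is not allowed, so no chain is taken.
    · rcases Nat.eq_zero_or_pos s with rfl | hs0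
      · exact ⟨[], by simp, by simp, by simp, by simp⟩
      obtain ⟨C', hC', hcard⟩ := exists_subset_card_eq (show r + s ≤ #C by omega)
      refine ⟨[C'], ?_, ?_, ?_, ?_⟩
      · simp only [List.mem_singleton, forall_eq]
        exact fun x hx y hy => hL C (by simp) x (hC' hx) y (hC' hy)
      · simp only [List.mem_singleton, forall_eq]; omega
      · simp only [List.map_cons, List.map_nil, List.sum_cons, List.sum_nil, add_zero]
        exact (sum_le_sum_of_subset_of_nonneg hC' fun _ _ _ => zero_le).trans
          (le_add_of_nonneg_right (zero_le))
      · simp [hcard]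

end Combinatorics

/-! ### Taylor expansion and Hasse derivatives -/

section Taylor

variable {σ R : Type*} [CommRing R]

/-- The Taylor expansion `f(x) ↦ f(x + z)`, as a polynomial in `z` over `R[x]`. -/
def taylor : MvPolynomial σ R →ₐ[R] MvPolynomial σ (MvPolynomial σ R) :=
  aeval fun i => C (X i) + X i

@[simp]
theorem taylor_X (i : σ) : taylor (X i : MvPolynomial σ R) = C (X i) + X i :=
  aeval_X _ i

/-- The Hasse derivative of `f` with exponent `c`. -/
def hasse (c : σ →₀ ℕ) (f : MvPolynomial σ R) : MvPolynomial σ R :=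
  coeff c (taylor f)

/-- The product of the binomial coefficients `(b i + c i).choose (c i)`. -/
def binom [Fintype σ] (b c : σ →₀ ℕ) : ℕ :=
  ∏ i, (b i + c i).choose (c i)

/-- The case of disjoint supports: the derivatives used to strip part of a leading exponent have
coefficient 1 there, so they do not vanish in positive characteristic. -/
theorem binom_eq_one [Fintype σ] {b c : σ →₀ ℕ} (h : ∀ i, b i = 0 ∨ c i = 0) :
    binom b c = 1 := by
  refine Finset.prod_eq_one fun i _ => ?_
  rcases h i with h | h <;> simp [h]

theorem binom_eq_mul [Fintype σ] [DecidableEq σ] (b c : σ →₀ ℕ) (j : σ) :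
    binom b c = (b j + c j).choose (c j) *
      ∏ i ∈ Finset.univ.erase j, (b i + c i).choose (c i) :=
  (Finset.mul_prod_erase _ _ (Finset.mem_univ j)).symm

theorem binom_congr [Fintype σ] {b c b' c' : σ →₀ ℕ} (j : σ)
    (h : ∀ i, i ≠ j → b i = b' i ∧ c i = c' i)
    (hj : (b j + c j).choose (c j) = (b' j + c' j).choose (c' j)) : binom b c = binom b' c' := by
  classical
  rw [binom_eq_mul b c j, binom_eq_mul b' c' j, hj]
  congr 1
  refine Finset.prod_congr rfl fun i hi => ?_
  obtain ⟨h1, h2⟩ := h i (Finset.ne_of_mem_erase hi)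
  rw [h1, h2]

theorem binom_pascal [Fintype σ] (b c : σ →₀ ℕ) (j : σ) :
    binom (b + Finsupp.single j 1) (c + Finsupp.single j 1) =
      binom b (c + Finsupp.single j 1) + binom (b + Finsupp.single j 1) c := by
  classical
  rw [binom_eq_mul _ _ j, binom_eq_mul b _ j, binom_eq_mul _ c j]
  have h : ∀ b' c' : σ →₀ ℕ, (∀ i, i ≠ j → b' i = b i ∧ c' i = c i) →
      ∏ i ∈ Finset.univ.erase j, (b' i + c' i).choose (c' i) =
        ∏ i ∈ Finset.univ.erase j, (b i + c i).choose (c i) := fun b' c' h =>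
    Finset.prod_congr rfl fun i hi => by
      rw [(h i (Finset.ne_of_mem_erase hi)).1, (h i (Finset.ne_of_mem_erase hi)).2]
  rw [h (b + Finsupp.single j 1), h b (c + Finsupp.single j 1), h (b + Finsupp.single j 1) c,
    ← add_mul]
  · congr 1
    simp only [Finsupp.add_apply, Finsupp.single_eq_same]
    rw [show b j + 1 + (c j + 1) = (b j + (c j + 1)) + 1 by ring, Nat.choose_succ_succ, add_comm]
    congr 2
    ring
  all_goals intro i hi; simp [Finsupp.single_eq_of_ne hi]

/-- This is the binomial expansion of (x + z)^(b + c), proved one variable at a time by Pascal's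
rule. -/
theorem coeff_hasse [Fintype σ] (b c : σ →₀ ℕ) (f : MvPolynomial σ R) :
    coeff b (hasse c f) = binom b c * coeff (b + c) f := by
  classical
  unfold hasse
  induction f using MvPolynomial.induction_on generalizing b c with
  | C a =>
    have : taylor (C a : MvPolynomial σ R) = C (C a) := by
      rw [← algebraMap_eq, AlgHom.commutes]; rfl
    rw [this, coeff_C]
    by_cases hc : c = 0
    · subst hc
      rw [binom_eq_one (fun i => .inr rfl)]
      simp
    · have : b + c ≠ 0 := fun h => hc (by simp_all)
      rw [if_neg (Ne.symm hc), coeff_C, if_neg this.symm]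
      simp
  | add p q hp hq =>
    rw [map_add, coeff_add, coeff_add, coeff_add, hp, hq]; ring
  | mul_X p j hp =>
    rw [map_mul, taylor_X, mul_add, coeff_add, coeff_add, mul_comm _ (C (X j)), coeff_C_mul,
      mul_comm (X j), coeff_mul_X', coeff_mul_X', coeff_mul_X']
    have hsub : ∀ a : σ →₀ ℕ, j ∈ a.support → ∃ a', a = a' + Finsupp.single j 1 := by
      intro a ha
      refine ⟨a - Finsupp.single j 1, (tsub_add_cancel_of_le ?_).symm⟩
      simpa [Nat.one_le_iff_ne_zero] using ha
    by_cases hb : j ∈ b.support <;> by_cases hc : j ∈ c.support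
    · obtain ⟨b, rfl⟩ := hsub b hb
      obtain ⟨c, rfl⟩ := hsub c hc
      have : j ∈ (b + Finsupp.single j 1 + (c + Finsupp.single j 1)).support := by simp
      rw [if_pos hb, if_pos hc, if_pos this, add_tsub_cancel_right, add_tsub_cancel_right, hp, hp,
        ← add_assoc (b + _) c, add_tsub_cancel_right, binom_pascal, add_right_comm b _ c,
        ← add_assoc b c]
      push_cast
      ring
    · obtain ⟨b, rfl⟩ := hsub b hb
      have : j ∈ (b + Finsupp.single j 1 + c).support := by simp
      rw [if_pos hb, if_neg hc, if_pos this, add_tsub_cancel_right, hp, add_right_comm,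
        add_tsub_cancel_right, coeff_zero, add_zero]
      congr 2
      have hc' : c j = 0 := by simpa using hc
      exact binom_congr j (fun i hi => by simp [Finsupp.single_eq_of_ne hi]) (by simp [hc'])
    · obtain ⟨c, rfl⟩ := hsub c hc
      have : j ∈ (b + (c + Finsupp.single j 1)).support := by simp
      rw [if_neg hb, if_pos hc, if_pos this, add_tsub_cancel_right, hp, ← add_assoc,
        add_tsub_cancel_right, zero_add]
      congr 2
      have hb' : b j = 0 := by simpa using hb
      exact binom_congr j (fun i hi => by simp [Finsupp.single_eq_of_ne hi]) (by simp [hb'])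
    · have : j ∉ (b + c).support := by simp_all
      rw [if_neg hb, if_neg hc, if_neg this]
      simp

end Taylor

/-! ### Matrices of bounded rank and lowering the rank -/

section RankIdeal

/-- The substitution `x_{ij} ↦ ∑ k, u_{ki} v_{kj}` parametrizing the matrices of rank at most `r`. -/
def factorMap (K : Type*) [Field K] (m n r : ℕ) :
    MvPolynomial (Fin m × Fin n) K →ₐ[K] MvPolynomial (Fin r × (Fin m ⊕ Fin n)) K :=
  aeval fun p => ∑ k, X (k, .inl p.1) * X (k, .inr p.2)

/-- The vanishing ideal of the generic matrix of rank at most `r`. -/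
def rankIdeal (K : Type*) [Field K] (m n r : ℕ) : Ideal (MvPolynomial (Fin m × Fin n) K) :=
  RingHom.ker (factorMap K m n r)

/-- The substitution `z_{ij} ↦ u_i v_j`. -/
def segre {m n : ℕ} (S : Type*) [CommRing S] :
    MvPolynomial (Fin m × Fin n) S →ₐ[S] MvPolynomial (Fin m ⊕ Fin n) S :=
  aeval fun p => X (.inl p.1) * X (.inr p.2)

/-- The row and column sums of an exponent matrix. -/
def margins {m n : ℕ} (c : Fin m × Fin n →₀ ℕ) : Fin m ⊕ Fin n →₀ ℕ :=
  c.mapDomain (fun p => .inl p.1) + c.mapDomain (fun p => .inr p.2)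

variable {K : Type*} [Field K] {m n r : ℕ}

theorem mem_rankIdeal {f : MvPolynomial (Fin m × Fin n) K} :
    f ∈ rankIdeal K m n r ↔ factorMap K m n r f = 0 :=
  RingHom.mem_ker

instance rankIdeal_isPrime : (rankIdeal K m n r).IsPrime :=
  RingHom.ker_isPrime _

theorem margins_add (c d : Fin m × Fin n →₀ ℕ) : margins (c + d) = margins c + margins d := by
  simp only [margins, Finsupp.mapDomain_add]
  abel

theorem margins_single (p : Fin m × Fin n) (k : ℕ) :
    margins (Finsupp.single p k) = Finsupp.single (.inl p.1) k + Finsupp.single (.inr p.2) k := by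
  simp [margins, Finsupp.mapDomain_single]

theorem segre_monomial {S : Type*} [CommRing S] (c : Fin m × Fin n →₀ ℕ) (a : S) :
    segre S (monomial c a) = monomial (margins c) a := by
  induction c using Finsupp.induction_linear generalizing a with
  | zero =>
    have : margins (0 : Fin m × Fin n →₀ ℕ) = 0 := by simp [margins]
    rw [this]
    exact AlgHom.commutes _ a
  | add c d hc hd =>
    rw [← mul_one a, ← monomial_mul, map_mul, hc, hd, monomial_mul, margins_add]
  | single p k =>
    rw [← mul_one a, ← C_mul_monomial, ← C_mul_monomial, map_mul, ← X_pow_eq_monomial, map_pow,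
      segre, aeval_X, margins_single, ← algebraMap_eq, AlgHom.commutes, mul_pow, X_pow_eq_monomial,
      X_pow_eq_monomial, monomial_mul, one_mul]
    rfl

/-- Monomials have the same image under z ↦ uv exactly when their margins agree, so each coefficient
collects one fibre of `margins`. -/
theorem coeff_segre_map {S S' : Type*} [CommRing S] [CommRing S'] (φ : S →+* S')
    (p : MvPolynomial (Fin m × Fin n) S) (e : Fin m ⊕ Fin n →₀ ℕ) :
    coeff e (segre S' (map φ p)) =
      φ (∑ c ∈ p.support with margins c = e, coeff c p) := by
  conv_lhs => rw [p.as_sum]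
  rw [map_sum, map_sum, coeff_sum, map_sum, Finset.sum_filter]
  refine Finset.sum_congr rfl fun c _ => ?_
  rw [map_monomial, segre_monomial, coeff_monomial]

/-- Splitting off the last rank one summand. -/
def splitLast (K : Type*) [Field K] (m n r : ℕ) :
    MvPolynomial (Fin (r + 1) × (Fin m ⊕ Fin n)) K →ₐ[K]
      MvPolynomial (Fin m ⊕ Fin n) (MvPolynomial (Fin r × (Fin m ⊕ Fin n)) K) :=
  aeval fun q => Fin.lastCases (motive := fun _ => MvPolynomial (Fin m ⊕ Fin n)
    (MvPolynomial (Fin r × (Fin m ⊕ Fin n)) K)) (X q.2) (fun k => C (X (k, q.2))) q.1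

/-- The generic matrix of rank at most r + 1 is y + uvᵀ with y of rank at most r: expand f at y and
put z = uvᵀ. -/
theorem splitLast_factorMap (f : MvPolynomial (Fin m × Fin n) K) :
    splitLast K m n r (factorMap K m n (r + 1) f) =
      segre _ (map (factorMap K m n r).toRingHom (taylor f)) := by
  have : (splitLast K m n r).comp (factorMap K m n (r + 1)) =
      ((segre _).restrictScalars K).comp ((mapAlgHom (factorMap K m n r)).comp taylor) := by
    refine MvPolynomial.algHom_ext fun p => ?_
    simp only [AlgHom.comp_apply, taylor_X, factorMap, aeval_X, map_sum, map_mul, map_add,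
      mapAlgHom_apply, splitLast, Fin.sum_univ_castSucc, Fin.lastCases_last,
      Fin.lastCases_castSucc, segre, AlgHom.restrictScalars_apply]
    simp [algebraMap_eq]
  exact DFunLike.congr_fun this f

/-- The sum of the Hasse derivatives of `f` over all exponents with given margins lowers the rank
by one. -/
theorem sum_hasse_mem_rankIdeal {f : MvPolynomial (Fin m × Fin n) K}
    (hf : f ∈ rankIdeal K m n (r + 1)) (e : Fin m ⊕ Fin n →₀ ℕ) :
    ∑ c ∈ (taylor f).support with margins c = e, hasse c f ∈ rankIdeal K m n r := by
  -- The left side vanishes, so every coefficient in u, v of the right side does; these are the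
  -- images of the sums in question.
  have h := splitLast_factorMap (r := r) f
  rw [mem_rankIdeal.mp hf, map_zero] at h
  have h' := coeff_segre_map (factorMap K m n r).toRingHom (taylor f) e
  rw [← h, coeff_zero] at h'
  exact h'.symm

end RankIdeal

open scoped MonomialOrder

/-! ### Term orders, antichains and leading exponents -/

section Order

variable {m n : ℕ}

/-- The strict order on matrix positions: strictly smaller row and strictly smaller column. -/
def Prec (p q : Fin m × Fin n) : Prop :=
  p.1 < q.1 ∧ p.2 < q.2

/-- The exchange property of a term order: in every `2 × 2` minor the diagonal term is larger. -/
def IsExchange (ord : MonomialOrder (Fin m × Fin n)) : Prop :=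
  ∀ i k j l, i < k → j < l →
    (Finsupp.single (i, l) 1 + Finsupp.single (k, j) 1) ≺[ord]
      (Finsupp.single (i, j) 1 + Finsupp.single (k, l) 1)

theorem degree_eq_of_coeff {σ R : Type*} [CommRing R] (ord : MonomialOrder σ)
    {g : MvPolynomial σ R} {b : σ →₀ ℕ} (hb : coeff b g ≠ 0)
    (h : ∀ a, b ≺[ord] a → coeff a g = 0) : ord.degree g = b := by
  refine ord.toSyn.injective (le_antisymm (ord.degree_le_iff.mpr fun a ha => ?_)
    (ord.le_degree (mem_support_iff.mpr hb)))
  by_contra hlt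
  exact mem_support_iff.mp ha (h a (not_le.mp hlt))

/-- The 2 × 2 minors suffice: the antidiagonal term lies in the support, hence below the leading
diagonal one. -/
theorem IsDiagonal.isExchange {K : Type*} [Field K] {ord : MonomialOrder (Fin m × Fin n)}
    (h : IsDiagonal K ord) : IsExchange ord := by
  classical
  intro i k j l hik hjl
  have hmono : ∀ {t : ℕ} {a b : Fin t}, a < b → StrictMono ![a, b] := by
    intro t a b hab x y hxy
    fin_cases x <;> fin_cases y <;> simp_all
  have h2 := h 2 (OrderEmbedding.ofStrictMono _ (hmono hik))
    (OrderEmbedding.ofStrictMono _ (hmono hjl))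
  rw [Matrix.det_fin_two] at h2
  simp only [Matrix.submatrix_apply, OrderEmbedding.coe_ofStrictMono, Matrix.mvPolynomialX_apply,
    Fin.prod_univ_two, Matrix.cons_val_zero, Matrix.cons_val_one] at h2
  have hX : ∀ p q : Fin m × Fin n, (X p * X q : MvPolynomial (Fin m × Fin n) K) =
      monomial (Finsupp.single p 1 + Finsupp.single q 1) 1 := fun p q => by
    rw [X, X, monomial_mul, one_mul]
  have hne : (Finsupp.single (i, j) 1 + Finsupp.single (k, l) 1 : Fin m × Fin n →₀ ℕ) ≠
      Finsupp.single (i, l) 1 + Finsupp.single (k, j) 1 := by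
    intro he
    have := DFunLike.congr_fun he (i, j)
    simp [hik.ne', hjl.ne'] at this
  rw [hX, hX] at h2
  have hdeg := congrArg ord.degree h2
  rw [ord.degree_leadingTerm, ord.degree_monomial, if_neg one_ne_zero] at hdeg
  refine lt_of_le_of_ne ?_ fun he => hne (ord.toSyn.injective he).symm
  rw [← hdeg]
  refine ord.le_degree (mem_support_iff.mpr ?_)
  rw [coeff_sub, coeff_monomial, coeff_monomial, if_neg hne, if_pos rfl]
  simp

/-- The lexicographic order reading the matrix row by row. -/
def rowLex (m n : ℕ) : MonomialOrder (Fin m × Fin n) where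
  syn := (MonomialOrder.lex : MonomialOrder (Fin m ×ₗ Fin n)).syn
  toSyn := (Finsupp.domCongr toLex).trans (MonomialOrder.lex : MonomialOrder (Fin m ×ₗ Fin n)).toSyn
  toSyn_monotone := fun _ _ hab =>
    (MonomialOrder.lex : MonomialOrder (Fin m ×ₗ Fin n)).toSyn_monotone fun i => hab (ofLex i)

/-- Provides one concrete order for the division in `symbolicPower_rankIdeal`, whose statement
mentions none. The first position where the two terms differ is (i, j). -/
theorem rowLex_isExchange : IsExchange (rowLex m n) := by
  intro i k j l hik hjl
  change (MonomialOrder.lex : MonomialOrder (Fin m ×ₗ Fin n)).toSyn (Finsupp.domCongr toLex _) <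
    (MonomialOrder.lex : MonomialOrder (Fin m ×ₗ Fin n)).toSyn (Finsupp.domCongr toLex _)
  rw [MonomialOrder.lex_lt_iff, Finsupp.Lex.lt_iff]
  refine ⟨toLex (i, j), fun d hd => ?_, ?_⟩
  · obtain ⟨⟨x, y⟩, rfl⟩ := toLex.surjective d
    simp only [Prod.Lex.toLex_lt_toLex] at hd
    have h1 : (i, l) ≠ (x, y) := by rintro h; cases h; omega
    have h2 : (k, j) ≠ (x, y) := by rintro h; cases h; omega
    have h3 : (i, j) ≠ (x, y) := by rintro h; cases h; omega
    have h4 : (k, l) ≠ (x, y) := by rintro h; cases h; omega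
    simp [h1, h2, h3, h4]
  · simp [hik.ne', hjl.ne']

theorem margins_inl (c : Fin m × Fin n →₀ ℕ) (i : Fin m) :
    margins c (.inl i) = ∑ j, c (i, j) := by
  classical
  induction c using Finsupp.induction_linear with
  | zero => simp [margins]
  | add c d hc hd => simp [margins_add, hc, hd, Finset.sum_add_distrib]
  | single p k =>
    obtain ⟨x, y⟩ := p
    rw [margins_single]
    by_cases h : x = i <;> simp [Finsupp.single_apply, h]

theorem margins_inr (c : Fin m × Fin n →₀ ℕ) (j : Fin n) :
    margins c (.inr j) = ∑ i, c (i, j) := by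
  classical
  induction c using Finsupp.induction_linear with
  | zero => simp [margins]
  | add c d hc hd => simp [margins_add, hc, hd, Finset.sum_add_distrib]
  | single p k =>
    obtain ⟨x, y⟩ := p
    rw [margins_single]
    by_cases h : y = j <;> simp [Finsupp.single_apply, h]

/-- The support is an antichain. -/
def IsAntichainExp (c : Fin m × Fin n →₀ ℕ) : Prop :=
  ∀ p ∈ c.support, ∀ q ∈ c.support, ¬ Prec p q

theorem exists_lt_of_sum_eq {ι : Type*} [Fintype ι] {f g : ι → ℕ} (h : ∑ i, f i = ∑ i, g i)
    {j : ι} (hj : f j < g j) : ∃ i, g i < f i := by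
  by_contra! hle
  exact absurd h (Finset.sum_lt_sum (fun i _ => hle i) ⟨j, Finset.mem_univ j, hj⟩).ne

/-- Exponents supported on antichains are determined by their margins. -/
theorem IsAntichainExp.eq_of_margins_eq {c d : Fin m × Fin n →₀ ℕ} (hc : IsAntichainExp c)
    (hd : IsAntichainExp d) (h : margins c = margins d) : c = d := by
  by_contra hne
  have hex : ∃ q : Fin m ×ₗ Fin n, c (ofLex q) ≠ d (ofLex q) := by
    by_contra! hall
    exact hne (Finsupp.ext fun p => hall (toLex p))
  obtain ⟨q, hq, hmin⟩ := WellFounded.has_min (wellFounded_lt (α := Fin m ×ₗ Fin n)) _ hex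
  obtain ⟨⟨i, j⟩, rfl⟩ := toLex.surjective q
  have hmin' : ∀ x y, x < i ∨ x = i ∧ y < j → c (x, y) = d (x, y) := by
    intro x y hxy
    by_contra hcd
    exact hmin (toLex (x, y)) hcd (Prod.Lex.toLex_lt_toLex.mpr hxy)
  -- An excess of c at the first difference (i, j) is made up by d in row i at some l > j, and this
  -- by c in column l at some k > i. So c contains the comparable positions (i, j) and (k, l).
  have key : ∀ c d : Fin m × Fin n →₀ ℕ, IsAntichainExp c → margins c = margins d →
      (∀ x y, x < i ∨ x = i ∧ y < j → c (x, y) = d (x, y)) → ¬ d (i, j) < c (i, j) := by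
    intro c d hc h hmin hlt
    have hrow : ∑ y, d (i, y) = ∑ y, c (i, y) := by rw [← margins_inl, ← margins_inl, h]
    obtain ⟨l, hl⟩ := exists_lt_of_sum_eq (f := fun y => d (i, y)) (g := fun y => c (i, y)) hrow hlt
    have hjl : j < l := by
      rcases lt_trichotomy l j with h' | rfl | h'
      · exact absurd (hmin i l (.inr ⟨rfl, h'⟩)) hl.ne
      · omega
      · exact h'
    have hcol : ∑ x, c (x, l) = ∑ x, d (x, l) := by rw [← margins_inr, ← margins_inr, h]
    obtain ⟨k, hk⟩ := exists_lt_of_sum_eq (f := fun x => c (x, l)) (g := fun x => d (x, l)) hcol hl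
    have hik : i < k := by
      rcases lt_trichotomy k i with h' | rfl | h'
      · exact absurd (hmin k l (.inl h')) hk.ne'
      · omega
      · exact h'
    exact hc (i, j) (Finsupp.mem_support_iff.mpr (by omega)) (k, l)
      (Finsupp.mem_support_iff.mpr (by omega)) ⟨hik, hjl⟩
  rcases lt_or_gt_of_ne hq with h' | h'
  · exact key d c hd h.symm (fun x y hxy => (hmin' x y hxy).symm) h'
  · exact key c d hc h hmin' h'

/-- An exponent supported on an antichain is minimal among the exponents with its margins. -/
theorem IsAntichainExp.le_of_margins_eq {ord : MonomialOrder (Fin m × Fin n)} (ho : IsExchange ord)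
    {c₀ : Fin m × Fin n →₀ ℕ} (hc₀ : IsAntichainExp c₀) (c : Fin m × Fin n →₀ ℕ)
    (h : margins c = margins c₀) : c₀ ≼[ord] c := by
  classical
  induction c using (InvImage.wf ord.toSyn wellFounded_lt).induction with
  | _ c ih =>
    by_cases hc : IsAntichainExp c
    · rw [hc.eq_of_margins_eq hc₀ h]
    · unfold IsAntichainExp at hc
      push Not at hc
      obtain ⟨⟨i, j⟩, hp, ⟨k, l⟩, hq, hik, hjl⟩ := hc
      dsimp only at hik hjl
      have hle : Finsupp.single (i, j) 1 + Finsupp.single (k, l) 1 ≤ c := by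
        intro z
        have h1 := Finsupp.mem_support_iff.mp hp
        have h2 := Finsupp.mem_support_iff.mp hq
        simp only [Finsupp.add_apply, Finsupp.single_apply]
        by_cases hz1 : (i, j) = z <;> by_cases hz2 : (k, l) = z
        · rw [← hz2] at hz1; cases hz1; omega
        · simp only [hz1, hz2, if_true, if_false]; subst hz1; omega
        · simp only [hz1, hz2, if_true, if_false]; subst hz2; omega
        · simp [hz1, hz2]
      -- Replacing a comparable pair by the antidiagonal pair keeps the margins and lowers the
      -- exponent; the descent can only end at c₀.
      obtain ⟨e, rfl⟩ := exists_add_of_le hle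
      have hlt := ho i k j l hik hjl
      have hlt' : (Finsupp.single (i, l) 1 + Finsupp.single (k, j) 1 + e) ≺[ord]
          (Finsupp.single (i, j) 1 + Finsupp.single (k, l) 1 + e) := by
        rw [map_add _ _ e, map_add _ _ e]
        exact add_lt_add_left hlt _
      refine (ih _ hlt' ?_).trans hlt'.le
      rw [← h]
      simp only [margins_add, margins_single]
      abel

/-- The leading exponent of a polynomial vanishing on the matrices of rank at most `r` is not
supported on a union of `r` antichains. -/
theorem not_colorable_of_mem_rankIdeal {K : Type*} [Field K] {ord : MonomialOrder (Fin m × Fin n)}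
    (ho : IsExchange ord) {r : ℕ} {f : MvPolynomial (Fin m × Fin n) K}
    (hf : f ∈ rankIdeal K m n r) (hf0 : f ≠ 0) (h : Fin m × Fin n → ℕ)
    (hr : ∀ p ∈ (ord.degree f).support, h p < r)
    (hh : ∀ p ∈ (ord.degree f).support, ∀ q ∈ (ord.degree f).support, Prec p q → h p ≠ h q) :
    False := by
  classical
  induction r generalizing f with
  | zero =>
    have h0 : ord.degree f = 0 := by
      ext p
      by_contra hp
      exact absurd (hr p (Finsupp.mem_support_iff.mpr hp)) (by simp)
    have hC := ord.eq_C_of_degree_eq_zero h0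
    rw [hC, mem_rankIdeal, ← algebraMap_eq, AlgHom.commutes, algebraMap_eq, C_eq_zero] at hf
    exact hf0 (ord.leadingCoeff_eq_zero_iff.mp hf)
  | succ r ih =>
    set M := ord.degree f with hM
    -- c₀ is the last colour class, b the rest. Any other c with the margins of c₀ is larger, so b +
    -- c lies above M and contributes nothing: g has leading exponent b, with r colours.
    set c₀ := M.filter (fun p => h p = r) with hc₀
    set b := M.filter (fun p => ¬ h p = r) with hb
    have hadd : b + c₀ = M := by
      rw [add_comm]; exact Finsupp.filter_add_filter_not M _
    have hanti : IsAntichainExp c₀ := by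
      intro p hp q hq hpq
      rw [hc₀, Finsupp.support_filter, Finset.mem_filter] at hp hq
      exact hh p hp.1 q hq.1 hpq (hp.2.trans hq.2.symm)
    have hmem := sum_hasse_mem_rankIdeal hf (margins c₀)
    set g := ∑ c ∈ (taylor f).support with margins c = margins c₀, hasse c f with hg
    have hcoeff : ∀ a, coeff a g =
        ∑ c ∈ (taylor f).support with margins c = margins c₀, binom a c * coeff (a + c) f := by
      intro a
      rw [hg, coeff_sum]
      exact Finset.sum_congr rfl fun c _ => coeff_hasse a c f
    have hone : binom b c₀ = 1 := binom_eq_one fun p => by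
      by_cases hp : h p = r
      · exact .inl (Finsupp.filter_apply_neg _ _ (by simpa using hp))
      · exact .inr (Finsupp.filter_apply_neg _ _ hp)
    have hfM : coeff M f ≠ 0 := ord.coeff_degree_ne_zero_iff.mpr hf0
    have hbg : coeff b g = coeff M f := by
      rw [hcoeff, Finset.sum_eq_single c₀, hone, hadd, Nat.cast_one, one_mul]
      · intro c hc hne
        have hle := hanti.le_of_margins_eq ho c (Finset.mem_filter.mp hc).2
        have hlt := lt_of_le_of_ne hle fun he => hne (ord.toSyn.injective he).symm
        rw [ord.coeff_eq_zero_of_lt, mul_zero]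
        rw [← hM, ← hadd, map_add, map_add]
        exact add_lt_add_right hlt _
      · intro hc
        exfalso
        refine hc (Finset.mem_filter.mpr ⟨mem_support_iff.mpr fun h0 => hfM ?_, rfl⟩)
        have := coeff_hasse b c₀ f
        rw [hasse, h0, coeff_zero, hone, hadd, Nat.cast_one, one_mul] at this
        exact this.symm
    have hdeg : ord.degree g = b := by
      refine degree_eq_of_coeff ord (by rwa [hbg]) fun a ha => ?_
      rw [hcoeff]
      refine Finset.sum_eq_zero fun c hc => ?_
      have hle := hanti.le_of_margins_eq ho c (Finset.mem_filter.mp hc).2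
      rw [ord.coeff_eq_zero_of_lt, mul_zero]
      rw [← hM, ← hadd, map_add, map_add]
      exact add_lt_add_of_lt_of_le ha hle
    have hsub : ∀ p ∈ b.support, p ∈ M.support ∧ h p ≠ r := fun p hp => by
      rwa [hb, Finsupp.support_filter, Finset.mem_filter] at hp
    refine ih hmem ?_ ?_ ?_
    · intro h0
      rw [h0, coeff_zero] at hbg
      exact hfM hbg.symm
    · rw [hdeg]
      intro p hp
      have h1 := hr p (hsub p hp).1
      have h2 := (hsub p hp).2
      omega
    · rw [hdeg]
      exact fun p hp q hq => hh p (hsub p hp).1 q (hsub q hq).1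

end Order

/-! ### Terms and leading exponents of minors -/

section Minors

variable {m n t : ℕ} {K : Type*} [Field K]

/-- The exponent of the term of a minor that belongs to the permutation `π`. -/
def permExp (a : Fin t ↪o Fin m) (b : Fin t ↪o Fin n) (π : Equiv.Perm (Fin t)) :
    Fin m × Fin n →₀ ℕ :=
  ∑ i, Finsupp.single (a (π i), b i) 1

theorem coeff_minor (a : Fin t ↪o Fin m) (b : Fin t ↪o Fin n) (e : Fin m × Fin n →₀ ℕ) :
    coeff e ((genericMatrix K m n).submatrix a b).det =
      ∑ π : Equiv.Perm (Fin t), if permExp a b π = e then ((Equiv.Perm.sign π : ℤ) : K) else 0 := by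
  classical
  rw [Matrix.det_apply', coeff_sum]
  refine Finset.sum_congr rfl fun π _ => ?_
  have : ∏ i, (genericMatrix K m n).submatrix a b (π i) i = monomial (permExp a b π) 1 := by
    rw [permExp, monomial_sum_one]
    rfl
  rw [this, ← map_intCast (C : K →+* MvPolynomial (Fin m × Fin n) K), coeff_C_mul, coeff_monomial]
  simp

theorem permExp_injective (a : Fin t ↪o Fin m) (b : Fin t ↪o Fin n) :
    Function.Injective (permExp a b) := by
  classical
  intro π ρ h
  ext1 i
  have h1 : permExp a b ρ (a (π i), b i) ≠ 0 := by
    rw [← h, permExp, Finsupp.finsetSum_apply]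
    refine (Finset.sum_pos' (fun _ _ => Nat.zero_le _) ⟨i, Finset.mem_univ i, ?_⟩).ne'
    simp
  rw [permExp, Finsupp.finsetSum_apply] at h1
  obtain ⟨k, -, hk⟩ := Finset.exists_ne_zero_of_sum_ne_zero h1
  rw [Finsupp.single_apply] at hk
  have hk' : (a (ρ k), b k) = (a (π i), b i) := by
    by_contra hne
    exact hk (if_neg hne)
  obtain ⟨h2, h3⟩ := Prod.mk.inj hk'
  rw [← b.injective h3, b.injective h3]
  rw [b.injective h3] at h2
  exact (a.injective h2).symm

/-- Undoing an inversion strictly raises the term by the exchange property, so the permutation with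
the largest term is increasing, hence the identity. -/
theorem permExp_le {ord : MonomialOrder (Fin m × Fin n)} (ho : IsExchange ord)
    (a : Fin t ↪o Fin m) (b : Fin t ↪o Fin n) (π : Equiv.Perm (Fin t)) :
    permExp a b π ≼[ord] permExp a b 1 := by
  classical
  obtain ⟨ρ, -, hρ⟩ := Finset.exists_max_image Finset.univ
    (fun π => ord.toSyn (permExp a b π)) Finset.univ_nonempty
  suffices ρ = 1 by
    rw [← this]; exact hρ π (Finset.mem_univ _)
  have hmono : StrictMono ρ := by
    intro i j hij
    by_contra hle
    have hlt : ρ j < ρ i := lt_of_le_of_ne (not_lt.mp hle) (ρ.injective.ne hij.ne')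
    have hji : j ∈ Finset.univ.erase i := Finset.mem_erase.mpr ⟨hij.ne', Finset.mem_univ _⟩
    have hsplit : ∀ τ : Equiv.Perm (Fin t), permExp a b τ = Finsupp.single (a (τ i), b i) 1 +
        (Finsupp.single (a (τ j), b j) 1 +
          ∑ k ∈ (Finset.univ.erase i).erase j, Finsupp.single (a (τ k), b k) 1) := by
      intro τ
      rw [Finset.add_sum_erase _ (fun k => Finsupp.single (a (τ k), b k) 1) hji,
        Finset.add_sum_erase _ (fun k => Finsupp.single (a (τ k), b k) 1) (Finset.mem_univ i)]
      rfl
    have hmax := hρ (ρ * Equiv.swap i j) (Finset.mem_univ _)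
    refine absurd hmax (not_le.mpr ?_)
    have hrest : ∑ k ∈ (Finset.univ.erase i).erase j,
          (Finsupp.single (a ((ρ * Equiv.swap i j) k), b k) 1 : Fin m × Fin n →₀ ℕ) =
        ∑ k ∈ (Finset.univ.erase i).erase j, Finsupp.single (a (ρ k), b k) 1 := by
      refine Finset.sum_congr rfl fun k hk => ?_
      have h1 := Finset.ne_of_mem_erase hk
      have h2 := Finset.ne_of_mem_erase (Finset.mem_of_mem_erase hk)
      rw [Equiv.Perm.mul_apply, Equiv.swap_apply_of_ne_of_ne h2 h1]
    rw [hsplit ρ, hsplit (ρ * Equiv.swap i j), hrest]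
    simp only [Equiv.Perm.mul_apply, Equiv.swap_apply_left, Equiv.swap_apply_right, ← add_assoc]
    rw [map_add _ _ (∑ k ∈ _, _), map_add _ _ (∑ k ∈ _, _)]
    refine add_lt_add_left ?_ _
    rw [add_comm (Finsupp.single (a (ρ i), b i) 1)]
    exact ho _ _ _ _ (a.strictMono hlt) (b.strictMono hij)
  ext1 i
  have : (StrictMono.orderIsoOfSurjective ρ hmono ρ.surjective) = OrderIso.refl _ :=
    Subsingleton.elim _ _
  exact DFunLike.congr_fun this i

theorem coeff_permExp_one (a : Fin t ↪o Fin m) (b : Fin t ↪o Fin n) :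
    coeff (permExp a b 1) ((genericMatrix K m n).submatrix a b).det = 1 := by
  rw [coeff_minor, Finset.sum_eq_single 1]
  · simp
  · intro π _ hπ
    rw [if_neg fun h => hπ (permExp_injective a b h)]
  · simp

theorem minor_ne_zero (a : Fin t ↪o Fin m) (b : Fin t ↪o Fin n) :
    ((genericMatrix K m n).submatrix a b).det ≠ 0 := fun h => by
  have := coeff_permExp_one (K := K) a b
  rw [h, coeff_zero] at this
  exact zero_ne_one this

theorem degree_minor {ord : MonomialOrder (Fin m × Fin n)} (ho : IsExchange ord)
    (a : Fin t ↪o Fin m) (b : Fin t ↪o Fin n) :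
    ord.degree ((genericMatrix K m n).submatrix a b).det = permExp a b 1 := by
  refine degree_eq_of_coeff ord (by rw [coeff_permExp_one]; exact one_ne_zero) fun e he => ?_
  rw [coeff_minor]
  refine Finset.sum_eq_zero fun π _ => if_neg fun h => ?_
  rw [← h] at he
  exact absurd he (not_lt.mpr (permExp_le ho a b π))

theorem degree_permExp (a : Fin t ↪o Fin m) (b : Fin t ↪o Fin n) (π : Equiv.Perm (Fin t)) :
    (permExp a b π).degree = t := by
  rw [permExp, map_sum]
  simp

theorem totalDegree_minor (a : Fin t ↪o Fin m) (b : Fin t ↪o Fin n) :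
    ((genericMatrix K m n).submatrix a b).det.totalDegree = t := by
  refine IsHomogeneous.totalDegree (fun e he => ?_) (minor_ne_zero a b)
  rw [coeff_minor] at he
  obtain ⟨π, -, hπ⟩ := Finset.exists_ne_zero_of_sum_ne_zero he
  have : permExp a b π = e := by
    by_contra hne
    exact hπ (if_neg hne)
  rw [← this]
  exact (DFunLike.congr_fun Finsupp.degree_eq_weight_one _).symm.trans (degree_permExp a b π)

end Minors

/-! ### Symbolic powers of primes and differentiation -/

section SymbolicPower

theorem mem_minimalPrimesCompl {R : Type*} [CommRing R] {J : Ideal R} [J.IsPrime] {x : R} :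
    x ∈ minimalPrimesCompl J ↔ x ∉ J := by
  change (∀ p ∈ J.minimalPrimes, x ∉ p) ↔ x ∉ J
  rw [Ideal.minimalPrimes_eq_subsingleton_self]
  simp

/-- A prime is its own only minimal prime, so the localization is the usual one at J. -/
theorem mem_symbolicPower {R : Type*} [CommRing R] {J : Ideal R} [J.IsPrime] {s : ℕ} {f : R} :
    f ∈ symbolicPower J s ↔ ∃ g ∉ J, g * f ∈ J ^ s := by
  rw [symbolicPower, Ideal.mem_comap,
    IsLocalization.algebraMap_mem_map_algebraMap_iff (minimalPrimesCompl J)]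
  simp only [mem_minimalPrimesCompl]

theorem mul_mem_symbolicPower {R : Type*} [CommRing R] {J : Ideal R} [J.IsPrime] {s t : ℕ}
    {f g : R} (hf : f ∈ symbolicPower J s) (hg : g ∈ symbolicPower J t) :
    f * g ∈ symbolicPower J (s + t) := by
  rw [mem_symbolicPower] at *
  obtain ⟨x, hx, hxf⟩ := hf
  obtain ⟨y, hy, hyg⟩ := hg
  refine ⟨x * y, fun h => (Ideal.IsPrime.mem_or_mem ‹_› h).elim hx hy, ?_⟩
  rw [mul_mul_mul_comm, pow_add]
  exact Ideal.mul_mem_mul hxf hyg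

theorem symbolicPower_one {R : Type*} [CommRing R] {J : Ideal R} [J.IsPrime] :
    symbolicPower J 1 = J := by
  ext f
  rw [mem_symbolicPower, pow_one]
  exact ⟨fun ⟨g, hg, h⟩ => (Ideal.IsPrime.mem_or_mem ‹_› h).resolve_left hg,
    fun h => ⟨1, (Ideal.ne_top_iff_one J).mp (Ideal.IsPrime.ne_top ‹_›), by simpa using h⟩⟩

/-- By induction on the degree of c, the coefficient of qp at c is q₀ times that of p, all other
terms involving lower coefficients of p. -/
theorem mem_pow_idealOfVars_of_mul_mem {σ T : Type*} [CommRing T] [IsDomain T]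
    {p q : MvPolynomial σ T} {s : ℕ} (hq : coeff 0 q ≠ 0) (h : q * p ∈ idealOfVars σ T ^ s) :
    p ∈ idealOfVars σ T ^ s := by
  classical
  rw [mem_pow_idealOfVars_iff'] at h ⊢
  intro c
  induction hd : c.degree using Nat.strong_induction_on generalizing c with
  | _ d ih =>
    intro hc
    have h1 := h c (hd.symm ▸ hc)
    rw [coeff_mul, Finset.sum_eq_single (0, c)] at h1
    · exact (mul_eq_zero.mp h1).resolve_left hq
    · rintro ⟨a, b⟩ hab hne
      rw [Finset.HasAntidiagonal.mem_antidiagonal] at hab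
      have hdeg : a.degree + b.degree = d := by rw [← hd, ← hab, map_add]
      have ha : a.degree ≠ 0 := by
        intro ha
        rw [Finsupp.degree_eq_zero_iff] at ha
        subst ha
        simp at hab
        exact hne (by rw [hab])
      rw [ih b.degree (by omega) b rfl (by omega), mul_zero]
    · simp

/-- Hasse derivatives of order less than `s` map the `s`-th symbolic power of the kernel of a
homomorphism to a domain into this kernel. -/
theorem hasse_mem_of_mem_symbolicPower {σ K T : Type*} [Fintype σ] [Field K] [CommRing T]
    [IsDomain T] (φ : MvPolynomial σ K →+* T) {s : ℕ} {f : MvPolynomial σ K}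
    (hf : f ∈ symbolicPower (RingHom.ker φ) s) {c : σ →₀ ℕ} (hc : c.degree < s) :
    hasse c f ∈ RingHom.ker φ := by
  have := RingHom.ker_isPrime φ
  obtain ⟨g, hg, hgf⟩ := mem_symbolicPower.mp hf
  -- Φ is the Taylor expansion at the generic point. Its constant term is φ, so the kernel goes into
  -- the ideal of the variables, while the multiplier g keeps a nonzero constant term and can be
  -- cancelled.
  let Φ : MvPolynomial σ K →+* MvPolynomial σ T := (map φ).comp taylor.toRingHom
  have hΦ : ∀ c h, coeff c (Φ h) = φ (hasse c h) := fun c h => coeff_map _ _ _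
  have h0 : ∀ h : MvPolynomial σ K, hasse 0 h = h := fun h => by
    ext b
    rw [coeff_hasse, binom_eq_one (fun _ => .inr rfl), add_zero, Nat.cast_one, one_mul]
  have hJ : (RingHom.ker φ).map Φ ≤ idealOfVars σ T := by
    rw [Ideal.map_le_iff_le_comap]
    intro h hh
    rw [Ideal.mem_comap, ← pow_one (idealOfVars σ T), mem_pow_idealOfVars_iff']
    intro x hx
    rw [Nat.lt_one_iff, Finsupp.degree_eq_zero_iff] at hx
    rw [hx, hΦ, h0]
    exact hh
  have hmem : Φ g * Φ f ∈ idealOfVars σ T ^ s := by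
    rw [← map_mul]
    have := Ideal.mem_map_of_mem Φ hgf
    rw [Ideal.map_pow] at this
    exact Ideal.pow_right_mono hJ s this
  have := mem_pow_idealOfVars_of_mul_mem (by rw [hΦ, h0]; exact hg) hmem
  rw [mem_pow_idealOfVars_iff'] at this
  rw [RingHom.mem_ker, ← hΦ]
  exact this c hc

end SymbolicPower

/-! ### Minors in symbolic powers of the rank ideal -/

section MinorsMem

variable {K : Type*} [Field K] {m n r : ℕ}

theorem det_mul_eq_zero_of_card_lt {ι κ R : Type*} [Fintype ι] [DecidableEq ι] [Fintype κ]
    [CommRing R] (h : Fintype.card κ < Fintype.card ι) (A : Matrix ι κ R) (B : Matrix κ ι R) :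
    (A * B).det = 0 := by
  classical
  have hpos : 0 < Fintype.card ι - Fintype.card κ := by omega
  let e : ι ≃ κ ⊕ Fin (Fintype.card ι - Fintype.card κ) :=
    Fintype.equivOfCardEq (by rw [Fintype.card_sum, Fintype.card_fin]; omega)
  -- Pad both factors to square matrices with zero columns and zero rows.
  have hAB : A * B = (Matrix.fromCols A 0).submatrix id e * (Matrix.fromRows B 0).submatrix e id := by
    rw [Matrix.submatrix_mul_equiv, Matrix.fromCols_mul_fromRows]
    simp
  rw [hAB, Matrix.det_mul, Matrix.det_eq_zero_of_column_eq_zero (e.symm (.inr ⟨0, hpos⟩)), zero_mul]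
  intro i
  simp

/-- The rows of the left factor of the generic matrix of rank at most `r`. -/
def leftFactor (K : Type*) [Field K] {m : ℕ} (n r : ℕ) {ι : Type*} (a : ι → Fin m) :
    Matrix ι (Fin r) (MvPolynomial (Fin r × (Fin m ⊕ Fin n)) K) :=
  Matrix.of fun i k => X (k, .inl (a i))

/-- The columns of the right factor of the generic matrix of rank at most `r`. -/
def rightFactor (K : Type*) [Field K] (m : ℕ) {n : ℕ} (r : ℕ) {ι : Type*} (b : ι → Fin n) :
    Matrix (Fin r) ι (MvPolynomial (Fin r × (Fin m ⊕ Fin n)) K) :=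
  Matrix.of fun k i => X (k, .inr (b i))

theorem factorMap_det {ι : Type*} [Fintype ι] [DecidableEq ι] (a : ι → Fin m) (b : ι → Fin n) :
    factorMap K m n r ((genericMatrix K m n).submatrix a b).det =
      (leftFactor K n r a * rightFactor K m r b).det := by
  rw [AlgHom.map_det]
  congr 1
  ext1 i j
  simp [Matrix.mul_apply, factorMap, leftFactor, rightFactor]

theorem det_mem_rankIdeal {ι : Type*} [Fintype ι] [DecidableEq ι] (h : r < Fintype.card ι)
    (a : ι → Fin m) (b : ι → Fin n) :
    ((genericMatrix K m n).submatrix a b).det ∈ rankIdeal K m n r := by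
  rw [mem_rankIdeal, factorMap_det]
  exact det_mul_eq_zero_of_card_lt (by simpa using h) _ _

theorem det_not_mem_rankIdeal {a : Fin r → Fin m} {b : Fin r → Fin n} (ha : Function.Injective a)
    (hb : Function.Injective b) :
    ((genericMatrix K m n).submatrix a b).det ∉ rankIdeal K m n r := by
  classical
  rw [mem_rankIdeal, factorMap_det]
  intro h
  -- Specialize the factors so that both chosen r × r blocks become the identity.
  have h' := congrArg (aeval (fun q : Fin r × (Fin m ⊕ Fin n) =>
    Sum.elim (fun i => if a q.1 = i then (1 : K) else 0) (fun j => if b q.1 = j then 1 else 0)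
      q.2)) h
  rw [AlgHom.map_det, map_zero, map_mul, Matrix.det_mul] at h'
  have h1 : ∀ k l, (a k = a l) ↔ (l = k) := fun k l => ⟨fun h => (ha h).symm, fun h => by rw [h]⟩
  have h2 : ∀ k l, (b k = b l) ↔ (k = l) := fun k l => hb.eq_iff
  refine mul_ne_zero (M₀ := K) ?_ ?_ h'
  · convert one_ne_zero (α := K)
    convert Matrix.det_one (n := Fin r) (R := K)
    ext i j
    simp [Matrix.one_apply, leftFactor, h1]
  · convert one_ne_zero (α := K)
    convert Matrix.det_one (n := Fin r) (R := K)
    ext i j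
    simp [Matrix.one_apply, rightFactor, h2]

/-- The determinant of a `k × k` matrix with entries in an ideal lies in its `k`-th power. -/
theorem det_mem_pow {R : Type*} [CommRing R] {k : ℕ} (I : Ideal R) (A : Matrix (Fin k) (Fin k) R)
    (h : ∀ i j, A i j ∈ I) : A.det ∈ I ^ k := by
  rw [Matrix.det_apply]
  refine Ideal.sum_mem _ fun π _ => ?_
  rw [Units.smul_def, zsmul_eq_mul]
  refine Ideal.mul_mem_left _ _ ?_
  have := Ideal.prod_mem_prod (s := Finset.univ) (I := fun _ : Fin k => I)
    (x := fun i => A (π i) i) (fun i _ => h _ _)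
  simpa using this

/-- A minor of size `r + k` lies in the `k`-th symbolic power of the rank ideal. -/
theorem minor_mem_symbolicPower {k : ℕ} (a : Fin (r + k) ↪o Fin m) (b : Fin (r + k) ↪o Fin n) :
    ((genericMatrix K m n).submatrix a b).det ∈ symbolicPower (rankIdeal K m n r) k := by
  classical
  set J := rankIdeal K m n r
  let L := Localization (minimalPrimesCompl J)
  let ι := algebraMap (MvPolynomial (Fin m × Fin n) K) L
  rw [symbolicPower, Ideal.mem_comap, Ideal.map_pow]
  let a' : Fin r ⊕ Fin k → Fin m := a ∘ finSumFinEquiv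
  let b' : Fin r ⊕ Fin k → Fin n := b ∘ finSumFinEquiv
  let Y : Matrix (Fin m) (Fin n) L := (genericMatrix K m n).map ι
  have hdet : ∀ {τ : Type} [Fintype τ] [DecidableEq τ] (p : τ → Fin m) (q : τ → Fin n),
      ι ((genericMatrix K m n).submatrix p q).det = (Y.submatrix p q).det := fun p q => by
    rw [RingHom.map_det]; rfl
  let A := Y.submatrix (a' ∘ Sum.inl) (b' ∘ Sum.inl)
  -- An r-minor is not in J, so it is invertible in the localization, and the big minor is a unit
  -- times the determinant of a k × k Schur complement.
  have hA : IsUnit A.det := by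
    rw [← hdet]
    exact IsLocalization.map_units L (⟨_, mem_minimalPrimesCompl.mpr (det_not_mem_rankIdeal
      ((a.injective.comp finSumFinEquiv.injective).comp Sum.inl_injective)
      ((b.injective.comp finSumFinEquiv.injective).comp Sum.inl_injective))⟩ :
        minimalPrimesCompl J)
  let _ : Invertible A := A.invertibleOfIsUnitDet hA
  have hblock : ∀ {τ : Type} [Fintype τ] [DecidableEq τ] (p : τ → Fin m) (q : τ → Fin n),
      (Y.submatrix (Sum.elim (a' ∘ Sum.inl) p) (Sum.elim (b' ∘ Sum.inl) q)).det =
        A.det * (Y.submatrix p q - Y.submatrix p (b' ∘ Sum.inl) * ⅟A *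
          Y.submatrix (a' ∘ Sum.inl) q).det := fun p q => by
    rw [← Matrix.det_fromBlocks₁₁]
    congr 1
    ext (i | i) (j | j) <;> rfl
  have hδ : ι ((genericMatrix K m n).submatrix a b).det =
      (Y.submatrix (Sum.elim (a' ∘ Sum.inl) (a' ∘ Sum.inr))
        (Sum.elim (b' ∘ Sum.inl) (b' ∘ Sum.inr))).det := by
    rw [Sum.elim_comp_inl_inr, Sum.elim_comp_inl_inr, hdet,
      ← Matrix.det_submatrix_equiv_self finSumFinEquiv (Y.submatrix a b)]
    rfl
  change ι _ ∈ _
  rw [hδ, hblock]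
  refine Ideal.mul_mem_left _ _ (det_mem_pow _ _ fun i j => ?_)
  -- Bordering A by one row and one column gives an (r+1)-minor, which lies in J and equals det A
  -- times the entry (i, j) of the Schur complement.
  have hmem := Ideal.mem_map_of_mem ι (det_mem_rankIdeal (K := K) (ι := Fin r ⊕ Unit) (r := r)
    (by simp) (Sum.elim (a' ∘ Sum.inl) fun _ => a' (.inr i))
    (Sum.elim (b' ∘ Sum.inl) fun _ => b' (.inr j)))
  rw [hdet, hblock, Matrix.det_unique (n := Unit)] at hmem
  exact (Ideal.unit_mul_mem_iff_mem _ hA).mp hmem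

end MinorsMem

/-! ### Joining with the rank one matrices -/

section Join

variable {K : Type*} [Field K] {m n r : ℕ}

theorem factorMap_one_eq_of_margins_eq {c d : Fin m × Fin n →₀ ℕ} (h : margins c = margins d) :
    (monomial c 1 - monomial d 1 : MvPolynomial (Fin m × Fin n) K) ∈ rankIdeal K m n 1 := by
  have hcomp : factorMap K m n 1 = (rename fun q => ((0 : Fin 1), q)).comp (segre K) := by
    refine MvPolynomial.algHom_ext fun p => ?_
    simp [factorMap, segre]
  rw [mem_rankIdeal, map_sub, hcomp]
  simp only [AlgHom.comp_apply, segre_monomial, h, sub_self]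

theorem rename_factorMap {r' : ℕ} (e : Fin r → Fin r') (g : MvPolynomial (Fin m × Fin n) K) :
    rename (fun q => (e q.1, q.2)) (factorMap K m n r g) =
      aeval (fun p => ∑ k : Fin r, X (e k, .inl p.1) * X (e k, .inr p.2)) g := by
  induction g using MvPolynomial.induction_on with
  | C a => simp
  | add p q hp hq => rw [map_add, map_add, hp, hq, map_add]
  | mul_X p i hp =>
    rw [map_mul, map_mul, hp, map_mul, aeval_X, factorMap, aeval_X, map_sum]
    simp only [map_mul, rename_X]

/-- Substitute for x the generic sum of r + 1 rank one matrices, for y the first r summands and for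
z the last: all generators of the ideal being contracted vanish. -/
theorem join_rankIdeal_le (K : Type*) [Field K] (m n r : ℕ) :
    join (rankIdeal K m n r) (rankIdeal K m n 1) ≤ rankIdeal K m n (r + 1) := by
  intro f hf
  rw [join, Ideal.mem_comap] at hf
  let v : (Fin m × Fin n) ⊕ (Fin m × Fin n) ⊕ (Fin m × Fin n) →
      MvPolynomial (Fin (r + 1) × (Fin m ⊕ Fin n)) K :=
    Sum.elim (fun p => ∑ k, X (k, .inl p.1) * X (k, .inr p.2))
      (Sum.elim (fun p => ∑ k : Fin r, X (k.castSucc, .inl p.1) * X (k.castSucc, .inr p.2))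
        -- The one-term sum matches `rename_factorMap` for inner dimension 1.
        (fun p => ∑ _k : Fin 1, X (Fin.last r, .inl p.1) * X (Fin.last r, .inr p.2)))
  suffices h : _ ≤ RingHom.ker (aeval (R := K) v) by
    have := h hf
    rw [RingHom.mem_ker, aeval_rename] at this
    exact this
  refine sup_le (sup_le ?_ ?_) ?_
  · rw [Ideal.map_le_iff_le_comap]
    intro g hg
    rw [Ideal.mem_comap, RingHom.mem_ker, aeval_rename]
    refine (rename_factorMap Fin.castSucc g).symm.trans ?_
    rw [mem_rankIdeal.mp hg, map_zero]
  · rw [Ideal.map_le_iff_le_comap]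
    intro g hg
    rw [Ideal.mem_comap, RingHom.mem_ker, aeval_rename]
    refine (rename_factorMap (fun _ : Fin 1 => Fin.last r) g).symm.trans ?_
    rw [mem_rankIdeal.mp hg, map_zero]
  · rw [Ideal.span_le]
    rintro _ ⟨p, rfl⟩
    rw [SetLike.mem_coe, RingHom.mem_ker, map_sub, map_sub, aeval_X, aeval_X, aeval_X]
    simp only [v, Sum.elim_inl, Sum.elim_inr, Fin.sum_univ_castSucc, Fin.sum_univ_zero]
    ring

/-- Modulo the ideal being contracted x = y + z, so f is the sum of its Hasse derivatives in y times
z^c. By J_1(z), z^c depends only on the margins of c, and grouping by margins leaves sums that lie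
in J_r(y). -/
theorem rankIdeal_le_join (K : Type*) [Field K] (m n r : ℕ) :
    rankIdeal K m n (r + 1) ≤ join (rankIdeal K m n r) (rankIdeal K m n 1) := by
  classical
  intro f hf
  rw [join, Ideal.mem_comap]
  set y := rename (R := K) fun i : Fin m × Fin n =>
    (Sum.inr (Sum.inl i) : (Fin m × Fin n) ⊕ (Fin m × Fin n) ⊕ (Fin m × Fin n)) with hy
  set z := rename (R := K) fun i : Fin m × Fin n =>
    (Sum.inr (Sum.inr i) : (Fin m × Fin n) ⊕ (Fin m × Fin n) ⊕ (Fin m × Fin n)) with hz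
  set 𝔍 := (rankIdeal K m n r).map y ⊔ (rankIdeal K m n 1).map z ⊔
    Ideal.span (Set.range fun i : Fin m × Fin n =>
      (X (Sum.inl i) - X (Sum.inr (Sum.inl i)) - X (Sum.inr (Sum.inr i)) :
        MvPolynomial ((Fin m × Fin n) ⊕ (Fin m × Fin n) ⊕ (Fin m × Fin n)) K))
  let q := Ideal.Quotient.mk 𝔍
  have hqy : ∀ g ∈ rankIdeal K m n r, q (y g) = 0 := fun g hg =>
    Ideal.Quotient.eq_zero_iff_mem.mpr
      (Ideal.mem_sup_left (Ideal.mem_sup_left (Ideal.mem_map_of_mem y hg)))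
  have hqz : ∀ g ∈ rankIdeal K m n 1, q (z g) = 0 := fun g hg =>
    Ideal.Quotient.eq_zero_iff_mem.mpr
      (Ideal.mem_sup_left (Ideal.mem_sup_right (Ideal.mem_map_of_mem z hg)))
  have hqx : ∀ p, q (X (Sum.inl p)) = q (y (X p)) + q (z (X p)) := fun p => by
    rw [hy, hz, rename_X, rename_X, ← map_add, Ideal.Quotient.eq]
    refine Ideal.mem_sup_right (Ideal.subset_span ⟨p, ?_⟩)
    ring
  have hexp : q (rename (fun i => Sum.inl i) f) =
      ∑ c ∈ (taylor f).support, q (y (hasse c f)) * q (z (monomial c 1)) := by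
    let ev : MvPolynomial (Fin m × Fin n) (MvPolynomial (Fin m × Fin n) K) →+* _ ⧸ 𝔍 :=
      eval₂Hom (q.comp y.toRingHom) (fun i => q (z (X i)))
    have hev : ∀ c g, ev (monomial c g) = q (y g) * q (z (monomial c 1)) := by
      intro c g
      rw [coe_eval₂Hom, eval₂_monomial, monomial_eq, C_1, one_mul, Finsupp.prod, Finsupp.prod,
        map_prod, map_prod]
      simp only [map_pow]
      rfl
    have hcomp : q.comp (rename (R := K) fun i : Fin m × Fin n => Sum.inl i).toRingHom =
        ev.comp taylor.toRingHom := by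
      refine MvPolynomial.ringHom_ext (fun a => ?_) fun p => ?_
      · have h1 : taylor (C a : MvPolynomial (Fin m × Fin n) K) = monomial 0 (C a) :=
          AlgHom.commutes taylor a
        simp only [RingHom.comp_apply, AlgHom.toRingHom_eq_coe, RingHom.coe_coe, rename_C, h1, hev]
        simp [hy, hz]
      · have h1 : taylor (X p : MvPolynomial (Fin m × Fin n) K) =
          monomial 0 (X p) + monomial (Finsupp.single p 1) 1 := taylor_X p
        simp only [RingHom.comp_apply, AlgHom.toRingHom_eq_coe, RingHom.coe_coe, rename_X, h1,
          map_add, hev, hqx]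
        simp [X]
    have h1 := DFunLike.congr_fun hcomp f
    simp only [RingHom.comp_apply, AlgHom.toRingHom_eq_coe, RingHom.coe_coe] at h1
    rw [h1, (taylor f).as_sum, map_sum, ← (taylor f).as_sum]
    exact Finset.sum_congr rfl fun c _ => hev c _
  rw [← Ideal.Quotient.eq_zero_iff_mem]
  change q _ = 0
  -- w e is the common class of the z^c with margins e; the value 0 serves the e that are no
  -- margins.
  have hZ : ∀ e, ∃ w, ∀ c, margins c = e → q (z (monomial c 1)) = w := by
    intro e
    by_cases he : ∃ c : Fin m × Fin n →₀ ℕ, margins c = e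
    · obtain ⟨d, hd⟩ := he
      refine ⟨q (z (monomial d 1)), fun c hc => ?_⟩
      rw [← sub_eq_zero, ← map_sub, ← map_sub]
      exact hqz _ (factorMap_one_eq_of_margins_eq (hc.trans hd.symm))
    · exact ⟨0, fun c hc => absurd ⟨c, hc⟩ he⟩
  choose w hw using hZ
  rw [hexp, ← Finset.sum_fiberwise_of_maps_to
    (fun c hc => Finset.mem_image_of_mem margins hc)]
  refine Finset.sum_eq_zero fun e _ => ?_
  calc ∑ c ∈ (taylor f).support with margins c = e, q (y (hasse c f)) * q (z (monomial c 1))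
      = ∑ c ∈ (taylor f).support with margins c = e, q (y (hasse c f)) * w e :=
        Finset.sum_congr rfl fun c hc => by rw [hw e c (Finset.mem_filter.mp hc).2]
    _ = q (y (∑ c ∈ (taylor f).support with margins c = e, hasse c f)) * w e := by
        rw [← Finset.sum_mul, map_sum, map_sum]
    _ = 0 := by rw [hqy _ (sum_hasse_mem_rankIdeal hf e), zero_mul]

end Join

/-! ### Products of minors and the main statements -/

section MinorProducts

variable {K : Type*} [Field K] {m n r s : ℕ}

/-- A chain of matrix positions is the diagonal of a minor. -/
theorem exists_permExp_eq_of_chain (C : Finset (Fin m × Fin n))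
    (hC : ∀ x ∈ C, ∀ y ∈ C, x ≠ y → Prec x y ∨ Prec y x) :
    ∃ (a : Fin C.card ↪o Fin m) (b : Fin C.card ↪o Fin n),
      permExp a b 1 = ∑ x ∈ C, Finsupp.single x 1 := by
  classical
  -- On a chain the lexicographic order agrees with `Prec`, so this enumeration increases in both
  -- coordinates.
  let e : Fin C.card ↪o Fin m ×ₗ Fin n :=
    (C.map (toLex : Fin m × Fin n ≃ Fin m ×ₗ Fin n).toEmbedding).orderEmbOfFin (Finset.card_map _)
  have hmem : ∀ i, ofLex (e i) ∈ C := fun i => by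
    have := Finset.orderEmbOfFin_mem
      (C.map (toLex : Fin m × Fin n ≃ Fin m ×ₗ Fin n).toEmbedding) (Finset.card_map _) i
    obtain ⟨x, hx, hxe⟩ := Finset.mem_map.mp this
    change toLex x = e i at hxe
    rw [← hxe]
    exact hx
  have hlt : ∀ i j, i < j → Prec (ofLex (e i)) (ofLex (e j)) := by
    intro i j hij
    have h1 : e i < e j := e.strictMono hij
    refine (hC _ (hmem i) _ (hmem j) fun h => h1.ne (ofLex.injective h)).resolve_right fun h2 => ?_
    exact absurd h1 (not_lt.mpr ((Prod.Lex.lt_iff.mpr (.inl h2.1)).le))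
  refine ⟨OrderEmbedding.ofStrictMono (fun i => (ofLex (e i)).1) fun i j h => (hlt i j h).1,
    OrderEmbedding.ofStrictMono (fun i => (ofLex (e i)).2) fun i j h => (hlt i j h).2, ?_⟩
  have hinj : Function.Injective fun i => ofLex (e i) := ofLex.injective.comp e.injective
  have himage : Finset.univ.image (fun i => ofLex (e i)) = C :=
    Finset.eq_of_subset_of_card_le
      (fun x hx => by
        obtain ⟨i, -, rfl⟩ := Finset.mem_image.mp hx
        exact hmem i)
      (by rw [Finset.card_image_of_injective _ hinj, Finset.card_univ, Fintype.card_fin])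
  have hsum : ∑ x ∈ Finset.univ.image (fun i => ofLex (e i)),
      (Finsupp.single x 1 : Fin m × Fin n →₀ ℕ) = ∑ i, Finsupp.single (ofLex (e i)) 1 :=
    Finset.sum_image fun i _ j _ h => hinj h
  rw [himage] at hsum
  exact hsum.symm

theorem mem_minorProducts_iff {g : MvPolynomial (Fin m × Fin n) K} :
    g ∈ minorProducts K m n r s ↔ ∃ L : List (MvPolynomial (Fin m × Fin n) K),
      (∀ f ∈ L, f ∈ minorsGE (genericMatrix K m n) (r + 1)) ∧
      (L.map fun f => (f.totalDegree : ℤ) - r).sum = s ∧ g = L.prod := by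
  constructor
  · rintro ⟨l, f, hf, hs, rfl⟩
    refine ⟨List.ofFn f, ?_, ?_, ?_⟩
    · intro x hx
      obtain ⟨i, rfl⟩ := List.mem_ofFn.mp hx
      exact hf i
    · rw [List.map_ofFn, List.sum_ofFn]
      exact hs
    · rw [List.prod_ofFn]
  · rintro ⟨L, hL, hs, rfl⟩
    refine ⟨L.length, L.get, fun i => hL _ (List.get_mem L i), ?_, ?_⟩
    · rw [← hs, ← List.sum_ofFn]
      congr 1
      conv_rhs => rw [← List.ofFn_get L, List.map_ofFn]
      rfl
    · conv_lhs => rw [← List.ofFn_get L, List.prod_ofFn]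

/-- Bounds the number of factors by s, and forces each part of a split product to have excess less
than s. -/
theorem one_le_totalDegree_sub {f : MvPolynomial (Fin m × Fin n) K}
    (hf : f ∈ minorsGE (genericMatrix K m n) (r + 1)) : 1 ≤ (f.totalDegree : ℤ) - r := by
  obtain ⟨t, ht, a, b, rfl⟩ := hf
  rw [totalDegree_minor]
  omega

theorem finite_minorsGE (K : Type*) [Field K] (m n r : ℕ) :
    (minorsGE (genericMatrix K m n) r).Finite := by
  refine Set.Finite.subset ((Set.finite_Iic m).biUnion (t := fun t => minors (genericMatrix K m n) t)
    fun t _ => ?_) ?_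
  · have h1 : Finite (Fin t ↪o Fin m) := Finite.of_injective _ DFunLike.coe_injective
    have h2 : Finite (Fin t ↪o Fin n) := Finite.of_injective _ DFunLike.coe_injective
    refine (Set.finite_range fun p : (Fin t ↪o Fin m) × (Fin t ↪o Fin n) =>
      ((genericMatrix K m n).submatrix p.1 p.2).det).subset ?_
    rintro _ ⟨a, b, rfl⟩
    exact ⟨(a, b), rfl⟩
  · rintro _ ⟨t, -, a, b, rfl⟩
    refine Set.mem_biUnion (x := t) ?_ ⟨a, b, rfl⟩
    simpa using Fintype.card_le_of_injective a a.injective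

theorem finite_minorProducts (K : Type*) [Field K] (m n r s : ℕ) :
    (minorProducts K m n r s).Finite := by
  refine Set.Finite.subset ((Set.finite_Iic s).biUnion
    (t := fun l => (fun f : Fin l → MvPolynomial (Fin m × Fin n) K => ∏ i, f i) ''
      Set.pi Set.univ fun _ => minorsGE (genericMatrix K m n) (r + 1))
    fun l _ => (Set.Finite.pi fun _ => finite_minorsGE K m n (r + 1)).image _) ?_
  rintro _ ⟨l, f, hf, hs, rfl⟩
  refine Set.mem_biUnion (x := l) ?_ ⟨f, fun i _ => hf i, rfl⟩
  have h1 : ∑ _i : Fin l, (1 : ℤ) ≤ ∑ i, (((f i).totalDegree : ℤ) - r) :=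
    Finset.sum_le_sum fun i _ => one_le_totalDegree_sub (hf i)
  rw [hs] at h1
  simpa using h1

theorem list_prod_degree (ord : MonomialOrder (Fin m × Fin n))
    (L : List (MvPolynomial (Fin m × Fin n) K)) (hL : ∀ f ∈ L, ord.Monic f) :
    ord.Monic L.prod ∧ ord.degree L.prod = (L.map ord.degree).sum := by
  induction L with
  | nil => simp
  | cons f L ih =>
    obtain ⟨h1, h2⟩ := ih fun g hg => hL g (List.mem_cons_of_mem f hg)
    have hf := hL f List.mem_cons_self
    rw [List.prod_cons, List.map_cons, List.sum_cons, ← h2]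
    exact ⟨hf.mul h1, ord.degree_mul hf.ne_zero h1.ne_zero⟩

theorem monic_minor {t : ℕ} {ord : MonomialOrder (Fin m × Fin n)} (ho : IsExchange ord)
    (a : Fin t ↪o Fin m) (b : Fin t ↪o Fin n) :
    ord.Monic ((genericMatrix K m n).submatrix a b).det := by
  rw [MonomialOrder.Monic, MonomialOrder.leadingCoeff, degree_minor ho, coeff_permExp_one]

theorem monic_of_mem_minorProducts {ord : MonomialOrder (Fin m × Fin n)} (ho : IsExchange ord)
    {g : MvPolynomial (Fin m × Fin n) K} (hg : g ∈ minorProducts K m n r s) : ord.Monic g := by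
  obtain ⟨L, hL, -, rfl⟩ := mem_minorProducts_iff.mp hg
  refine (list_prod_degree ord L fun f hf => ?_).1
  obtain ⟨t, -, a, b, rfl⟩ := hL f hf
  exact monic_minor ho a b

/-- The leading exponent of an element of the symbolic power is divisible by the leading exponent
of a product of minors. -/
theorem exists_minorProduct_degree_le {ord : MonomialOrder (Fin m × Fin n)} (ho : IsExchange ord)
    {f : MvPolynomial (Fin m × Fin n) K} (hf : f ∈ symbolicPower (rankIdeal K m n r) s)
    (hf0 : f ≠ 0) : ∃ g ∈ minorProducts K m n r s, ord.degree g ≤ ord.degree f := by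
  classical
  obtain ⟨L, A, h, hL, hLM, hA, hh, hle⟩ := exists_chains_and_antichains
    (Prec : Fin m × Fin n → Fin m × Fin n → Prop) (fun x hx => lt_irrefl _ hx.1)
    (fun x y z hxy hyz => ⟨hxy.1.trans hyz.1, hxy.2.trans hyz.2⟩) (ord.degree f) r
  set M := ord.degree f with hM
  by_cases hs : (s : ℤ) ≤ (L.map fun C => (C.card : ℤ) - r).sum
  · obtain ⟨L', hL', hcard, hsum, hexc⟩ := exists_chains_excess_eq r s L hL hs
    have hG : ∀ C : Finset (Fin m × Fin n), ∃ g : MvPolynomial (Fin m × Fin n) K, C ∈ L' →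
        g ∈ minors (genericMatrix K m n) C.card ∧ g.totalDegree = C.card ∧ ord.Monic g ∧
        ord.degree g = ∑ x ∈ C, Finsupp.single x 1 := by
      intro C
      by_cases hC : C ∈ L'
      · obtain ⟨a, b, hab⟩ := exists_permExp_eq_of_chain C (hL' C hC)
        exact ⟨_, fun _ => ⟨⟨a, b, rfl⟩, totalDegree_minor a b, monic_minor ho a b,
          (degree_minor ho a b).trans hab⟩⟩
      · exact ⟨0, fun h => absurd h hC⟩
    choose G hG using hG
    refine ⟨(L'.map G).prod, mem_minorProducts_iff.mpr ⟨L'.map G, ?_, ?_, rfl⟩, ?_⟩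
    · intro g hg
      obtain ⟨C, hC, rfl⟩ := List.mem_map.mp hg
      exact ⟨C.card, hcard C hC, (hG C hC).1⟩
    · rw [← hexc, List.map_map]
      refine congrArg List.sum (List.map_congr_left fun C hC => ?_)
      rw [Function.comp_apply, (hG C hC).2.1]
    · have hmonic : ∀ g ∈ L'.map G, ord.Monic g := by
        intro g hg
        obtain ⟨C, hC, rfl⟩ := List.mem_map.mp hg
        exact (hG C hC).2.2.1
      rw [(list_prod_degree ord _ hmonic).2, List.map_map]
      refine le_trans (le_of_eq ?_) (hsum.trans hLM)
      refine congrArg List.sum (List.map_congr_left fun C hC => ?_)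
      rw [Function.comp_apply, (hG C hC).2.2.2]
  · exfalso
    -- The uncoloured part c has degree below s, so differentiating by c stays in J_r and leaves the
    -- leading exponent b, which is covered by r antichains.
    set c := M.filter (fun p => p ∉ A) with hc
    set b := M.filter (fun p => p ∈ A) with hb
    have hadd : b + c = M := Finsupp.filter_add_filter_not M _
    have hdegc : c.degree < s := by
      have h1 : (c.degree : ℤ) = ∑ x ∈ Aᶜ, (M x : ℤ) := by
        rw [Finsupp.degree_eq_sum, Finset.compl_eq_univ_sdiff, Finset.sdiff_eq_filter,
          Finset.sum_filter]
        push_cast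
        refine Finset.sum_congr rfl fun x _ => ?_
        rw [hc, Finsupp.filter_apply]
        split_ifs <;> simp
      omega
    have hone : binom b c = 1 := binom_eq_one fun p => by
      by_cases hp : p ∈ A
      · exact .inr (Finsupp.filter_apply_neg _ _ (by simpa using hp))
      · exact .inl (Finsupp.filter_apply_neg _ _ hp)
    have hfM : coeff M f ≠ 0 := ord.coeff_degree_ne_zero_iff.mpr hf0
    have hcoeff : coeff b (hasse c f) = coeff M f := by
      rw [coeff_hasse, hone, hadd, Nat.cast_one, one_mul]
    have hdeg : ord.degree (hasse c f) = b := by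
      refine degree_eq_of_coeff ord (by rwa [hcoeff]) fun a ha => ?_
      rw [coeff_hasse, ord.coeff_eq_zero_of_lt, mul_zero]
      rw [← hM, ← hadd, map_add, map_add]
      exact add_lt_add_left ha _
    have hsub : ∀ p ∈ b.support, p ∈ A := fun p hp => by
      rw [hb, Finsupp.support_filter, Finset.mem_filter] at hp
      exact hp.2
    refine not_colorable_of_mem_rankIdeal ho (K := K) (r := r) (f := hasse c f)
      (hasse_mem_of_mem_symbolicPower (factorMap K m n r).toRingHom hf hdegc) ?_ h ?_ ?_
    · intro h0
      rw [h0, coeff_zero] at hcoeff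
      exact hfM hcoeff.symm
    · rw [hdeg]
      exact fun p hp => hA p (hsub p hp)
    · rw [hdeg]
      exact fun p hp q hq => hh p (hsub p hp) q (hsub q hq)

theorem list_prod_mem_symbolicPower (L : List (MvPolynomial (Fin m × Fin n) K))
    (hL : ∀ f ∈ L, f ∈ minorsGE (genericMatrix K m n) (r + 1))
    (hs : (L.map fun f => (f.totalDegree : ℤ) - r).sum = s) :
    L.prod ∈ symbolicPower (rankIdeal K m n r) s := by
  induction L generalizing s with
  | nil =>
    have : s = 0 := by simpa using hs.symm
    subst this
    rw [symbolicPower, pow_zero, Ideal.one_eq_top, Ideal.map_top, Ideal.comap_top]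
    trivial
  | cons f L ih =>
    obtain ⟨t, ht, a, b, rfl⟩ := hL f List.mem_cons_self
    have hL' := fun g hg => hL g (List.mem_cons_of_mem _ hg)
    have hnonneg : 0 ≤ (L.map fun f => (f.totalDegree : ℤ) - r).sum := by
      refine List.sum_nonneg fun x hx => ?_
      obtain ⟨g, hg, rfl⟩ := List.mem_map.mp hx
      exact zero_le_one.trans (one_le_totalDegree_sub (hL' g hg))
    rw [List.map_cons, List.sum_cons, totalDegree_minor] at hs
    obtain ⟨k, rfl⟩ := Nat.exists_eq_add_of_le (show r ≤ t by omega)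
    have h1 := ih (s := s - k) hL' (by push_cast at hs; omega)
    rw [List.prod_cons, show s = k + (s - k) by push_cast at hs; omega]
    exact mul_mem_symbolicPower (minor_mem_symbolicPower a b) h1

theorem minorProducts_subset_symbolicPower :
    minorProducts K m n r s ⊆ symbolicPower (rankIdeal K m n r) s := by
  intro g hg
  obtain ⟨L, hL, hs, rfl⟩ := mem_minorProducts_iff.mp hg
  exact list_prod_mem_symbolicPower L hL hs

/-- Divide f by the monic products: a nonzero remainder would lie in the symbolic power, with
leading exponent divisible by none of theirs. -/
theorem symbolicPower_rankIdeal (K : Type*) [Field K] (m n r s : ℕ) :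
    symbolicPower (rankIdeal K m n r) s = Ideal.span (minorProducts K m n r s) := by
  refine le_antisymm (fun f hf => ?_) (Ideal.span_le.mpr minorProducts_subset_symbolicPower)
  have ho := rowLex_isExchange (m := m) (n := n)
  obtain ⟨g, p, hfg, -, hp⟩ := (rowLex m n).div_set (B := minorProducts K m n r s)
    (fun b hb => by rw [(monic_of_mem_minorProducts ho hb).leadingCoeff_eq_one]; exact isUnit_one) f
  have hlin : Finsupp.linearCombination _ (fun b : minorProducts K m n r s => b.1) g ∈
      Ideal.span (minorProducts K m n r s) := by
    rw [Finsupp.linearCombination_apply]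
    exact Ideal.sum_mem _ fun b _ => Ideal.mul_mem_left _ _ (Ideal.subset_span b.2)
  have hp0 : p = 0 := by
    by_contra hp0
    have hmem : p ∈ symbolicPower (rankIdeal K m n r) s := by
      rw [← (Ideal.add_mem_iff_right _
        (Ideal.span_le.mpr minorProducts_subset_symbolicPower hlin)), ← hfg]
      exact hf
    obtain ⟨b, hb, hle⟩ := exists_minorProduct_degree_le ho hmem hp0
    exact hp _ ((rowLex m n).degree_mem_support hp0) b hb hle
  rw [hfg, hp0, add_zero]
  exact hlin

theorem isGroebnerBasis_minorProducts {ord : MonomialOrder (Fin m × Fin n)} (ho : IsExchange ord) :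
    IsGroebnerBasis ord (symbolicPower (rankIdeal K m n r) s) (minorProducts K m n r s) := by
  refine ⟨finite_minorProducts K m n r s, minorProducts_subset_symbolicPower,
    le_antisymm (Ideal.span_mono (Set.image_mono minorProducts_subset_symbolicPower))
      (Ideal.span_le.mpr ?_)⟩
  rintro _ ⟨f, hf, rfl⟩
  by_cases hf0 : f = 0
  · rw [hf0, ord.leadingTerm_zero]
    exact Ideal.zero_mem _
  obtain ⟨g, hg, hle⟩ := exists_minorProduct_degree_le ho hf hf0
  have : ord.leadingTerm f =
      monomial (ord.degree f - ord.degree g) (ord.leadingCoeff f) * ord.leadingTerm g := by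
    rw [MonomialOrder.leadingTerm, MonomialOrder.leadingTerm, monomial_mul,
      tsub_add_cancel_of_le hle, (monic_of_mem_minorProducts ho hg).leadingCoeff_eq_one, mul_one]
  rw [this]
  exact Ideal.mul_mem_left _ _ (Ideal.subset_span ⟨g, hg, rfl⟩)

/-- The case s = 1: since every factor has excess at least 1, some factor is a minor of size exactly
r + 1. -/
theorem minorIdeal_eq_rankIdeal (K : Type*) [Field K] (m n r : ℕ) :
    minorIdeal K m n (r + 1) = rankIdeal K m n r := by
  apply le_antisymm
  · refine Ideal.span_le.mpr ?_
    rintro _ ⟨a, b, rfl⟩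
    exact det_mem_rankIdeal (by simp) a b
  · rw [← symbolicPower_one (J := rankIdeal K m n r), symbolicPower_rankIdeal, Ideal.span_le]
    intro g hg
    obtain ⟨L, hL, hs, rfl⟩ := mem_minorProducts_iff.mp hg
    cases L with
    | nil => simp at hs
    | cons f L =>
      have hnonneg : 0 ≤ (L.map fun f => (f.totalDegree : ℤ) - r).sum := by
        refine List.sum_nonneg fun x hx => ?_
        obtain ⟨g, hg, rfl⟩ := List.mem_map.mp hx
        exact zero_le_one.trans (one_le_totalDegree_sub (hL g (List.mem_cons_of_mem _ hg)))
      obtain ⟨t, ht, a, b, rfl⟩ := hL f List.mem_cons_self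
      rw [List.map_cons, List.sum_cons, totalDegree_minor] at hs
      obtain rfl : t = r + 1 := by omega
      rw [List.prod_cons]
      exact Ideal.mul_mem_right _ _ (Ideal.subset_span ⟨a, b, rfl⟩)

theorem secantIdeal_eq_rankIdeal (K : Type*) [Field K] (m n : ℕ) {r : ℕ} (hr : 1 ≤ r) :
    secantIdeal (minorIdeal K m n 2) r = rankIdeal K m n r := by
  induction r, hr using Nat.le_induction with
  | base => exact minorIdeal_eq_rankIdeal K m n 1
  | succ r hr ih =>
    obtain ⟨k, rfl⟩ := Nat.exists_eq_add_of_le' hr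
    rw [secantIdeal, ih, minorIdeal_eq_rankIdeal K m n 1]
    exact le_antisymm (join_rankIdeal_le K m n (k + 1)) (rankIdeal_le_join K m n (k + 1))

/-- A product with one factor is a minor of size r + s, hence in J_{r+s-1}; a longer one splits into
two parts of positive excess. -/
theorem isDiffPerfect_minorIdeal (K : Type*) [Field K] (m n : ℕ) :
    IsDiffPerfect (minorIdeal K m n 2) := by
  intro r hr s hs
  rw [secantIdeal_eq_rankIdeal K m n hr,
    secantIdeal_eq_rankIdeal K m n (show 1 ≤ r + s - 1 by omega)]
  apply le_antisymm
  · rw [symbolicPower_rankIdeal, Ideal.span_le]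
    intro g hg
    obtain ⟨L, hL, hsum, rfl⟩ := mem_minorProducts_iff.mp hg
    match L with
    | [] =>
      simp only [List.map_nil, List.sum_nil] at hsum
      omega
    | [f] =>
      obtain ⟨t, ht, a, b, rfl⟩ := hL f List.mem_cons_self
      simp only [List.map_cons, List.map_nil, List.sum_cons, List.sum_nil, add_zero,
        totalDegree_minor] at hsum
      rw [List.prod_singleton]
      refine Ideal.mem_sup_left (det_mem_rankIdeal ?_ a b)
      rw [Fintype.card_fin]
      omega
    | f :: f' :: L =>
      have hL' : ∀ g ∈ f' :: L, g ∈ minorsGE (genericMatrix K m n) (r + 1) := fun g hg =>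
        hL g (List.mem_cons_of_mem _ hg)
      have hpos : 1 ≤ ((f' :: L).map fun f => (f.totalDegree : ℤ) - r).sum := by
        rw [List.map_cons, List.sum_cons]
        have h1 := one_le_totalDegree_sub (hL' f' List.mem_cons_self)
        have h2 : 0 ≤ (L.map fun f => (f.totalDegree : ℤ) - r).sum := by
          refine List.sum_nonneg fun x hx => ?_
          obtain ⟨g, hg, rfl⟩ := List.mem_map.mp hx
          exact zero_le_one.trans (one_le_totalDegree_sub (hL' g (List.mem_cons_of_mem _ hg)))
        omega
      obtain ⟨t, ht, a, b, rfl⟩ := hL f List.mem_cons_self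
      obtain ⟨k, rfl⟩ := Nat.exists_eq_add_of_le (show r ≤ t by omega)
      rw [List.map_cons, List.sum_cons, totalDegree_minor] at hsum
      push_cast at hsum
      rw [List.prod_cons]
      -- k ≥ 1 since the first factor has size above r, and k ≤ s - 1 since the remaining factors
      -- have excess at least 1.
      have hk : k ∈ Finset.Icc 1 (s - 1) := Finset.mem_Icc.mpr (by omega)
      refine Ideal.mem_sup_right (Finset.single_le_sum (f := fun i =>
        symbolicPower (rankIdeal K m n r) i * symbolicPower (rankIdeal K m n r) (s - i))
        (fun _ _ => bot_le) hk (Ideal.mul_mem_mul (minor_mem_symbolicPower a b)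
          (list_prod_mem_symbolicPower _ hL' ?_)))
      omega
  · refine sup_le ?_ ?_
    · rw [← minorIdeal_eq_rankIdeal, Nat.sub_add_cancel (by omega)]
      refine Ideal.span_le.mpr ?_
      rintro _ ⟨a, b, rfl⟩
      exact minor_mem_symbolicPower a b
    · rw [Ideal.sum_eq_sup, Finset.sup_le_iff]
      intro i hi
      obtain ⟨h1, h2⟩ := Finset.mem_Icc.mp hi
      refine Ideal.mul_le.mpr fun x hx y hy => ?_
      have := mul_mem_symbolicPower hx hy
      rwa [Nat.add_sub_cancel' (by omega)] at this

end MinorProducts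

end DetSymb

end

theorem mainTheorem7 (K : Type*) [Field K] [IsAlgClosed K] (m n : ℕ) :
    DetSymb.IsDiffPerfect (DetSymb.minorIdeal K m n 2) ∧
    ∀ r : ℕ, 1 ≤ r →
      DetSymb.secantIdeal (DetSymb.minorIdeal K m n 2) r = DetSymb.minorIdeal K m n (r + 1) ∧
      ∀ s : ℕ, 1 ≤ s →
        DetSymb.symbolicPower (DetSymb.secantIdeal (DetSymb.minorIdeal K m n 2) r) s =
            Ideal.span (DetSymb.minorProducts K m n r s) ∧
        ∀ ord : MonomialOrder (Fin m × Fin n), DetSymb.IsDiagonal K ord →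
          DetSymb.IsGroebnerBasis ord
            (DetSymb.symbolicPower (DetSymb.secantIdeal (DetSymb.minorIdeal K m n 2) r) s)
            (DetSymb.minorProducts K m n r s) := by
  refine ⟨DetSymb.isDiffPerfect_minorIdeal K m n, fun r hr => ?_⟩
  rw [DetSymb.secantIdeal_eq_rankIdeal K m n hr, DetSymb.minorIdeal_eq_rankIdeal]
  exact ⟨rfl, fun s _ => ⟨DetSymb.symbolicPower_rankIdeal K m n r s,
    fun ord ho => DetSymb.isGroebnerBasis_minorProducts ho.isExchange⟩⟩
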